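/- Let $d\in\{2,3\}$ and let $\Omega\subset\mathbb R^d$ be a bounded polygonal/polyhedral domain with outward unit normal $n$, triangulated by a conforming simplicial mesh $\mathcal T_h$, i.e. $\overline\Omega$ is the union of the finitely many closed simplices $K\in\mathcal T_h$ (and $\Omega$ is the interior of this union), any two of which meet in a common face or not at all. Write $h_K=\operatorname{diam}K$, $h=\max_K h_K$, $h_F=\operatorname{diam}F$ for a $(d-1)$-dimensional face $F$, $\mathcal F_{int}$ for the set of interior faces, $(\cdot,\cdot)$ for the $L^2(\Omega)$ and $\langle\cdot,\cdot\rangle_{\partial\Omega}$ for the $L^2(\partial\Omega)$ scalar product, $[\![\cdot]\!]$ for the jump over a face, and $(t)_\pm=\tfrac12(t\pm|t|)$. Let $\mu>0$, $\beta\in[C^2(\overline\Omega)]^d$, $c\in C^1(\overline\Omega)$, and let $V_h=W_h$ be the space $X_h^1$ of continuous functions on $\overline\Omega$ that are affine on every $K\in\mathcal T_h$. Define $$a(u,v)=(\mu\nabla u,\nabla v)+(\nabla\cdot(\beta u)+cu,v),$$ $$a_h(u,v)=a(u,v)-\theta\langle\nabla u\cdot n,v\rangle_{\partial\Omega}-\theta\langle\nabla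 v\cdot n,u\rangle_{\partial\Omega}-\langle(\beta\cdot n)_-u,v\rangle_{\partial\Omega},$$ where $\theta$ is any real number (in particular $\theta=1$, or the consistent choice $\theta=\mu$), and $$s_{cip}(u,v)=\sum_{F\in\mathcal F_{int}}\int_F\big(h_F\gamma_{1,F}[\![\nabla u]\!]\cdot[\![\nabla v]\!]+h_F^3\gamma_{2,F}[\![\Delta u]\!][\![\Delta v]\!]\big)\,ds,$$ $$s_{bc}^{\pm}(u,v)=\langle\mu h^{-1}u,v\rangle_{\partial\Omega}+\langle|(\beta\cdot n)_\pm|u,v\rangle_{\partial\Omega},\qquad s_p=s_{cip}+s_{bc}^-,\qquad s_a=s_{cip}+s_{bc}^+,$$ where derivatives are taken elementwise. Assume that, with positive constants and for all $F\in\mathcal F_{int}$, $\gamma_{1,F}\sim\mu+\|\beta_h\cdot n_F\|_{\infty,F}\,h_F$ and $\gamma_{2,F}\sim\mu$, where $n_F$ is a unit normal to $F$, $\beta_h$ is the piecewise affine nodal interpolant of $\beta$, and $x\sim y$ means two-sided bounds $m\,y\le x\le M\,y$ with constants $m,M>0$ independent of $F$. Then for every $f\in L^2(\Omega)$ and every function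 $u$ on $\overline\Omega$ that is $C^2$ on each closed element (for example a sufficiently regular exact solution of the continuous problem), there is exactly one pair $(u_h,z_h)\in V_h\times W_h$ such that $$a_h(u_h,w_h)+s_a(z_h,w_h)=(f,w_h)\quad\text{and}\quad a_h(v_h,z_h)-s_p(u_h,v_h)=-s_p(u,v_h)$$ for all $v_h\in V_h$ and $w_h\in W_h$. The same holds if $s_p(u,\cdot)$ on the right-hand side is replaced by an arbitrary linear functional on $V_h$. -/

import Mathlib

open scoped InnerProductSpace MeasureTheory

noncomputable section

namespace NonCoerciveFEM

/-- The Euclidean space `ℝ^d`. -/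
abbrev E (d : ℕ) : Type := EuclideanSpace ℝ (Fin d)

/-- A (conforming) triangulation of a bounded polygonal / polyhedral domain of `ℝ^d`: a finite,
nonempty simplicial complex in which every simplex is a face of a `d`-dimensional simplex.
Simplices are given by their finite vertex sets. -/
structure Triangulation (d : ℕ) where
  complex : Geometry.SimplicialComplex ℝ (E d)
  finite : complex.faces.Finite
  nonempty : complex.faces.Nonempty
  pure : ∀ s ∈ complex.faces, ∃ t ∈ complex.faces, s ⊆ t ∧ t.card = d + 1

/-- The closed simplex spanned by a finite set of vertices. -/
def simplex {d : ℕ} (s : Finset (E d)) : Set (E d) := convexHull ℝ (s : Set (E d))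

/-- The diameter of the simplex `s` (`h_K` for an element, `h_F` for a face). -/
def diam {d : ℕ} (s : Finset (E d)) : ℝ := Metric.diam (simplex s)

/-- The barycentre of the simplex `s`. -/
def barycentre {d : ℕ} (s : Finset (E d)) : E d := (s.card : ℝ)⁻¹ • ∑ v ∈ s, v

/-- The unit normal to the face `F` of the element `K`, pointing out of `K`: the normalised
component orthogonal to `F` of the vector from the barycentre of `K` to that of `F`. -/
def normal {d : ℕ} (K F : Finset (E d)) : E d :=
  let w := (vectorSpan ℝ (F : Set (E d)))ᗮ.starProjection (barycentre F - barycentre K)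
  ‖w‖⁻¹ • w

/-- The surface integral of `g` over the `(d-1)`-dimensional simplex `F`. -/
def faceIntegral {d : ℕ} (F : Finset (E d)) (g : E d → ℝ) : ℝ :=
  ∫ x in simplex F, g x ∂μHE[d - 1]

/-- The gradient of `u` restricted to the closed element `K`; at points of a face of `K` this is
the trace of the gradient taken from `K`. -/
def gradOn {d : ℕ} (K : Finset (E d)) (u : E d → ℝ) (x : E d) : E d :=
  gradientWithin u (simplex K) x

/-- The Laplacian of `u` restricted to the closed element `K`. -/
def lapOn {d : ℕ} (K : Finset (E d)) (u : E d → ℝ) (x : E d) : ℝ :=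
  InnerProductSpace.laplacianWithin u (simplex K) x

/-- The divergence of the vector field `g` restricted to the closed element `K`. -/
def divOn {d : ℕ} (K : Finset (E d)) (g : E d → E d) (x : E d) : ℝ :=
  ∑ i : Fin d, (fderivWithin ℝ g (simplex K) x (EuclideanSpace.single i 1)) i

/-- Positive part `(t)_+ = (t + |t|) / 2`. -/
def pos (t : ℝ) : ℝ := (t + |t|) / 2

/-- Negative part, with its sign, `(t)_- = (t - |t|) / 2`. -/
def neg (t : ℝ) : ℝ := (t - |t|) / 2

/-- `‖β_h · n‖_{∞,F}`, where `β_h` is the piecewise affine nodal interpolant of `β`: at the point of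
`F` with barycentric coordinates `w` it takes the value `∑ w_v β(v)`. -/
def interpNormalSup {d : ℕ} (β : E d → E d) (F : Finset (E d)) (n : E d) : ℝ :=
  ⨆ w : stdSimplex ℝ F, |⟪∑ v : F, (w : F → ℝ) v • β v, n⟫_ℝ|

namespace Triangulation

variable {d : ℕ} (T : Triangulation d)

/-- The closure `Ω̄` of the domain: the union of all closed simplices. -/
def closedDomain : Set (E d) := T.complex.space

/-- The domain `Ω`. -/
def domain : Set (E d) := interior T.closedDomain

/-- `Ω̄` is indeed the closure of `Ω`. -/
theorem closure_domain : closure T.domain = T.closedDomain := by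
  have hcl : IsClosed T.closedDomain := by
    unfold closedDomain Geometry.SimplicialComplex.space
    exact T.finite.isClosed_biUnion fun s _ => (s.finite_toSet.isCompact_convexHull ℝ).isClosed
  apply subset_antisymm
  · exact closure_minimal interior_subset hcl
  · intro x hx
    obtain ⟨s, hs, hxs⟩ := Geometry.SimplicialComplex.mem_space_iff.1 hx
    obtain ⟨t, ht, hst, hcard⟩ := T.pure s hs
    have hxt : x ∈ convexHull ℝ (t : Set (E d)) :=
      convexHull_mono (Finset.coe_subset.2 hst) hxs
    have hspan : affineSpan ℝ (t : Set (E d)) = ⊤ := by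
      have h := (T.complex.indep ht).affineSpan_eq_top_iff_card_eq_finrank_add_one.2
        (by simp [hcard])
      simpa using h
    have hne : (interior (convexHull ℝ (t : Set (E d)))).Nonempty :=
      interior_convexHull_nonempty_iff_affineSpan_eq_top.2 hspan
    have hc := (convex_convexHull ℝ (t : Set (E d))).closure_interior_eq_closure_of_nonempty_interior
      hne
    have hx' : x ∈ closure (interior (convexHull ℝ (t : Set (E d)))) := by
      rw [hc]; exact subset_closure hxt
    exact closure_mono
      (interior_mono (Geometry.SimplicialComplex.convexHull_subset_space ht)) hx'

open Classical in
/-- The elements: the simplices of full dimension. -/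
def elements : Finset (Finset (E d)) := T.finite.toFinset.filter fun s => s.card = d + 1

open Classical in
/-- The elements having `F` as a face. -/
def elementsAt (F : Finset (E d)) : Finset (Finset (E d)) := T.elements.filter fun K => F ⊆ K

open Classical in
/-- The `(d-1)`-dimensional faces shared by two elements. -/
def interiorFaces : Finset (Finset (E d)) :=
  T.finite.toFinset.filter fun F => F.card = d ∧ (T.elementsAt F).card = 2

open Classical in
/-- The `(d-1)`-dimensional faces belonging to one element only; their union is `∂Ω`. -/
def boundaryFaces : Finset (Finset (E d)) :=
  T.finite.toFinset.filter fun F => F.card = d ∧ (T.elementsAt F).card = 1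

/-- The mesh size `h`, the largest diameter of an element. -/
def meshSize : ℝ := sSup (diam '' (T.elements : Set (Finset (E d))))

/-- The finite element space `X_h^k` of continuous functions on `Ω̄` whose restriction to each
element is a polynomial of degree at most `k`. A function on `Ω̄` is represented by its extension
by zero to `ℝ^d`. -/
def feSpace (k : ℕ) : Submodule ℝ (E d → ℝ) where
  carrier := {v | (∀ x, x ∉ T.closedDomain → v x = 0) ∧ ContinuousOn v T.closedDomain ∧
    ∀ K ∈ T.elements, ∃ p : MvPolynomial (Fin d) ℝ, p.totalDegree ≤ k ∧
      ∀ x ∈ simplex K, v x = MvPolynomial.eval (fun i => x i) p}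
  zero_mem' := ⟨fun _ _ => rfl, continuousOn_const, fun _ _ => ⟨0, by simp, by simp⟩⟩
  add_mem' := by
    rintro v w ⟨hv, hvc, hvp⟩ ⟨hw, hwc, hwp⟩
    refine ⟨fun x hx => by simp [hv x hx, hw x hx], hvc.add hwc, fun K hK => ?_⟩
    obtain ⟨p, hp, hpe⟩ := hvp K hK
    obtain ⟨q, hq, hqe⟩ := hwp K hK
    exact ⟨p + q, (MvPolynomial.totalDegree_add p q).trans (max_le hp hq),
      fun x hx => by simp [hpe x hx, hqe x hx]⟩
  smul_mem' := by
    rintro r v ⟨hv, hvc, hvp⟩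
    refine ⟨fun x hx => by simp [hv x hx], hvc.const_smul r, fun K hK => ?_⟩
    obtain ⟨p, hp, hpe⟩ := hvp K hK
    exact ⟨r • p, (MvPolynomial.totalDegree_smul_le r p).trans hp,
      fun x hx => by simp [hpe x hx, MvPolynomial.smul_eval]⟩

/-- The `L²(∂Ω)`-type integral of a function which may depend on the element `K` from which the
trace is taken and on the boundary face `F` (for instance through the outward normal). -/
def boundaryIntegral (g : Finset (E d) → Finset (E d) → E d → ℝ) : ℝ :=
  ∑ F ∈ T.boundaryFaces, ∑ K ∈ T.elementsAt F, faceIntegral F (g K F)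

/-- `a(u,v) = (μ ∇u, ∇v) + (∇·(β u) + c u, v)`; the integrals over `Ω` are written as sums over the
elements. -/
def a (μ : ℝ) (β : E d → E d) (c : E d → ℝ) (u v : E d → ℝ) : ℝ :=
  (∑ K ∈ T.elements, ∫ x in simplex K, μ * ⟪gradOn K u x, gradOn K v x⟫_ℝ) +
  ∑ K ∈ T.elements, ∫ x in simplex K, (divOn K (fun y => u y • β y) x + c x * u x) * v x

/-- The discrete bilinear form with weakly imposed Dirichlet condition,
`a(u,v) - θ ⟨∇u·n, v⟩_{∂Ω} - θ ⟨∇v·n, u⟩_{∂Ω} - ⟨(β·n)_- u, v⟩_{∂Ω}`. -/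
def ah (μ : ℝ) (β : E d → E d) (c : E d → ℝ) (θ : ℝ) (u v : E d → ℝ) : ℝ :=
  T.a μ β c u v
    - θ * T.boundaryIntegral (fun K F x => ⟪gradOn K u x, normal K F⟫_ℝ * v x)
    - θ * T.boundaryIntegral (fun K F x => ⟪gradOn K v x, normal K F⟫_ℝ * u x)
    - T.boundaryIntegral (fun K F x => neg ⟪β x, normal K F⟫_ℝ * u x * v x)

/-- The product `⟦∇u⟧ · ⟦∇v⟧` of the jumps of the gradients over the interior face `F`. The sum runs
over ordered pairs of elements at `F`, so both orientations of the jump contribute (equally). -/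
def gradJumpProd (F : Finset (E d)) (u v : E d → ℝ) (x : E d) : ℝ :=
  (1 / 2) * ∑ K ∈ T.elementsAt F, ∑ K' ∈ T.elementsAt F,
    ⟪gradOn K u x - gradOn K' u x, gradOn K v x - gradOn K' v x⟫_ℝ

/-- The product `⟦Δu⟧ ⟦Δv⟧` of the jumps of the Laplacians over the interior face `F`. -/
def lapJumpProd (F : Finset (E d)) (u v : E d → ℝ) (x : E d) : ℝ :=
  (1 / 2) * ∑ K ∈ T.elementsAt F, ∑ K' ∈ T.elementsAt F,
    (lapOn K u x - lapOn K' u x) * (lapOn K v x - lapOn K' v x)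

/-- The continuous interior penalty stabilisation. -/
def scip (γ₁ γ₂ : Finset (E d) → ℝ) (u v : E d → ℝ) : ℝ :=
  ∑ F ∈ T.interiorFaces, faceIntegral F fun x =>
    diam F * γ₁ F * T.gradJumpProd F u v x + diam F ^ 3 * γ₂ F * T.lapJumpProd F u v x

/-- The boundary stabilisation `⟨μ h⁻¹ u, v⟩_{∂Ω} + ⟨|σ(β·n)| u, v⟩_{∂Ω}`, where `σ` is
`(·)_+` or `(·)_-`. -/
def sbc (σ : ℝ → ℝ) (μ : ℝ) (β : E d → E d) (u v : E d → ℝ) : ℝ :=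
  T.boundaryIntegral (fun _ _ x => μ * T.meshSize⁻¹ * u x * v x) +
  T.boundaryIntegral (fun K F x => |σ ⟪β x, normal K F⟫_ℝ| * u x * v x)

/-- The stabilisation `s_p` of the primal equation. -/
def sp (μ : ℝ) (β : E d → E d) (γ₁ γ₂ : Finset (E d) → ℝ) (u v : E d → ℝ) : ℝ :=
  T.scip γ₁ γ₂ u v + T.sbc neg μ β u v

/-- The stabilisation `s_a` of the adjoint equation. -/
def sa (μ : ℝ) (β : E d → E d) (γ₁ γ₂ : Finset (E d) → ℝ) (u v : E d → ℝ) : ℝ :=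
  T.scip γ₁ γ₂ u v + T.sbc pos μ β u v

/-- `γ₁,F ∼ μ + ‖β_h·n_F‖_{∞,F} h_F` and `γ₂,F ∼ μ` on the interior faces, `∼` meaning two-sided
bounds with positive constants. (The reference value does not depend on the orientation of `n_F`,
so it may be computed from either element at `F`.) -/
def AdmissibleParameters (μ : ℝ) (β : E d → E d) (γ₁ γ₂ : Finset (E d) → ℝ) : Prop :=
  (∃ m M : ℝ, 0 < m ∧ 0 < M ∧ ∀ F ∈ T.interiorFaces, ∀ K ∈ T.elementsAt F,
    m * (μ + interpNormalSup β F (normal K F) * diam F) ≤ γ₁ F ∧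
    γ₁ F ≤ M * (μ + interpNormalSup β F (normal K F) * diam F)) ∧
  ∃ m M : ℝ, 0 < m ∧ 0 < M ∧ ∀ F ∈ T.interiorFaces, m * μ ≤ γ₂ F ∧ γ₂ F ≤ M * μ

/-- `(uh, zh)` solves the finite element formulation with `V_h = W_h = X_h^k`, source `f`, and
right-hand side `-ℓ(v_h)` in the second equation. -/
def IsFEMSolution (k : ℕ) (μ : ℝ) (β : E d → E d) (c : E d → ℝ) (θ : ℝ)
    (γ₁ γ₂ : Finset (E d) → ℝ) (f : E d → ℝ) (ℓ : T.feSpace k → ℝ)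
    (uh zh : T.feSpace k) : Prop :=
  (∀ wh : T.feSpace k,
    T.ah μ β c θ uh wh + T.sa μ β γ₁ γ₂ zh wh = ∫ x in T.domain, f x * wh.1 x) ∧
  ∀ vh : T.feSpace k, T.ah μ β c θ vh zh - T.sp μ β γ₁ γ₂ uh vh = -ℓ vh

end Triangulation

end NonCoerciveFEM

end

/-! The two equations form a square linear system on a finite-dimensional space, so existence and
uniqueness for all data follow from injectivity. With zero data, test the first equation with `z_h`
and the second with `u_h` and subtract: the form `a_h`, on which no coercivity is assumed, cancels,
leaving `s_p(u_h,u_h) + s_a(z_h,z_h) = 0`. Everything thus rests on both stabilisations being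
definite on continuous piecewise affine functions (`eq_zero_of_stabilisation_eq_zero`);
`existsUnique_primalDual` is the algebraic part.

If a stabilisation vanishes at `u`, each of its nonnegative pieces vanishes. A nonnegative
continuous function with zero integral over a face is zero there, so the gradient of `u` does not
jump across interior faces and `u = 0` on boundary faces. To conclude `u = 0` without any
connectedness of the domain, suppose `u x ≠ 0` for some `x` inside an element. Follow a ray from `x`
along which the local affine function does not move towards zero, and which misses all faces of
codimension at least two. Take its last point `y` in the elements on which `u` equals that affine
function. There `u y ≠ 0`, and `y` lies in the relative interior of a `(d-1)`-face. If that face is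
interior, the neighbour carries the same affine function (same gradient, same value at `y`) and the
ray continues into one of the two elements; if it is a boundary face, `u y = 0`. Both are
contradictions (`eq_zero_of_mem_interior_simplex`).

The remaining work shows that the integrals depend linearly on their discrete arguments, which needs
integrability over elements and faces. -/

namespace NonCoerciveFEM
open MeasureTheory Measure Module Set Filter Topology

/-! ### Hausdorff measure on compact convex sets -/

section ConvexMeasure

variable {V : Type*} [NormedAddCommGroup V] [InnerProductSpace ℝ V] [FiniteDimensional ℝ V]
  [MeasurableSpace V] [BorelSpace V]

/-- A compact convex set has positive and finite Euclidean Hausdorff measure in the dimension of its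
affine span. -/
theorem euclideanHausdorffMeasure_convex {s : Set V} (hs : Convex ℝ s) (hc : IsCompact s)
    (hne : s.Nonempty) {n : ℕ} (hn : finrank ℝ (vectorSpan ℝ s) = n) :
    0 < (μHE[n] : Measure V) s ∧ (μHE[n] : Measure V) s < ⊤ := by
  obtain ⟨x₀, hx₀⟩ := id hne
  let S := affineSpan ℝ s
  let p : S := ⟨x₀, subset_affineSpan ℝ s hx₀⟩
  let t : Set S := (↑) ⁻¹' s
  have himg : ((↑) : S → V) '' t = s := by
    exact (Subtype.image_preimage_coe _ _).trans (inter_eq_right.2 (subset_affineSpan ℝ s))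
  have : Nonempty S := ⟨p⟩
  -- Translating by `p` identifies the affine span isometrically with its direction, a Euclidean
  -- space of dimension exactly `n`, where the measure is Lebesgue volume.
  have hmeas : (μHE[n] : Measure V) s = (volume : Measure S.direction)
      ((IsometryEquiv.vaddConst p) ⁻¹' t) := by
    have hfr : finrank ℝ S.direction = n := by rw [← hn]; exact congrArg (fun W : Submodule ℝ V => finrank ℝ W) (direction_affineSpan ℝ s)
    conv_lhs => rw [← himg]
    rw [AffineSubspace.euclideanHausdorffMeasure_coe_image, ← hfr,
      EuclideanGeometry.euclideanHausdorffMeasure_eq p]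
    exact (IsometryEquiv.vaddConst p).toHomeomorph.toMeasurableEquiv.map_apply _
  -- A nonempty convex set in finite dimension has nonempty interior relative to its affine span.
  have hint : (interior t).Nonempty := by
    have := Set.Nonempty.intrinsicInterior hs hne
    rw [intrinsicInterior] at this
    exact this.of_image
  have htc : IsCompact t :=
    Topology.IsEmbedding.subtypeVal.isCompact_iff.2 (by rw [himg]; exact hc)
  rw [hmeas]
  constructor
  · apply measure_pos_of_nonempty_interior
    obtain ⟨y, hy⟩ := hint
    refine ⟨(IsometryEquiv.vaddConst p).symm y, ?_⟩
    apply (preimage_interior_subset_interior_preimage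
      (IsometryEquiv.vaddConst p).continuous)
    simpa using hy
  · exact ((IsometryEquiv.vaddConst p).toHomeomorph.isCompact_preimage.2 htc).measure_lt_top

/-- A continuous function on a compact convex set is integrable with respect to the Hausdorff
measure of the right dimension. -/
theorem integrableOn_euclideanHausdorffMeasure_convex {s : Set V} (hs : Convex ℝ s)
    (hc : IsCompact s) {n : ℕ} (hn : finrank ℝ (vectorSpan ℝ s) = n) {g : V → ℝ}
    (hg : ContinuousOn g s) : IntegrableOn g s (μHE[n] : Measure V) := by
  rcases s.eq_empty_or_nonempty with rfl | hne
  · simp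
  have hms : MeasurableSet s := hc.isClosed.measurableSet
  obtain ⟨C, hC⟩ := hc.exists_bound_of_continuousOn hg
  have : IsFiniteMeasure ((μHE[n] : Measure V).restrict s) :=
    ⟨by simpa using (euclideanHausdorffMeasure_convex hs hc hne hn).2⟩
  exact Integrable.of_bound (hg.aestronglyMeasurable hms) C ((ae_restrict_mem hms).mono hC)

/-- A nonnegative continuous function on a compact convex set whose integral with respect to the
Hausdorff measure of the right dimension vanishes is zero. -/
theorem eq_zero_of_setIntegral_euclideanHausdorffMeasure_eq_zero {s : Set V} (hs : Convex ℝ s)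
    (hc : IsCompact s) {n : ℕ} (hn : finrank ℝ (vectorSpan ℝ s) = n) {g : V → ℝ}
    (hg : ContinuousOn g s) (hg0 : ∀ x ∈ s, 0 ≤ g x)
    (hgi : ∫ x in s, g x ∂(μHE[n] : Measure V) = 0)
    {x : V} (hx : x ∈ s) : g x = 0 := by
  obtain ⟨hpos, hfin⟩ := euclideanHausdorffMeasure_convex hs hc ⟨x, hx⟩ hn
  have hms : MeasurableSet s := hc.isClosed.measurableSet
  have hint := integrableOn_euclideanHausdorffMeasure_convex hs hc hn hg
  rw [setIntegral_eq_zero_iff_of_nonneg_ae ((ae_restrict_mem hms).mono hg0) hint] at hgi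
  by_contra hgx
  have hnhds : ∀ᶠ y in 𝓝[s] x, g y ≠ 0 := (hg x hx).eventually_ne hgx
  obtain ⟨ε, hε, hball⟩ := Metric.mem_nhdsWithin_iff.1 hnhds
  obtain ⟨R, hR⟩ := hc.isBounded.subset_ball x
  have hR0 : 0 < R := by
    have := hR hx
    simpa using this
  -- Shrinking `s` towards `x` by the ratio `r` keeps it inside `s` (convexity, `r ≤ 1`) and brings
  -- it into the ball where `g ≠ 0` (`r ≤ ε / R`). This also works when `x` is a relative boundary
  -- point.
  set r : ℝ := min 1 (ε / R) with hr
  have hr0 : 0 < r := lt_min one_pos (div_pos hε hR0)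
  have hsub : AffineMap.homothety x r '' s ⊆ Metric.ball x ε ∩ s := by
    rintro _ ⟨y, hy, rfl⟩
    refine ⟨?_, ?_⟩
    · have h1 : dist y x < R := hR hy
      have h2 : r * R ≤ ε := by
        calc r * R ≤ ε / R * R := by gcongr; exact min_le_right _ _
          _ = ε := by field_simp
      rw [Metric.mem_ball, dist_homothety_center, Real.norm_eq_abs, abs_of_pos hr0, dist_comm]
      calc r * dist y x < r * R := by gcongr
        _ ≤ ε := h2
    · have := hs.add_smul_sub_mem hx hy ⟨hr0.le, min_le_left _ _⟩
      simpa [AffineMap.homothety_apply, add_comm] using this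
  -- The shrunken copy lies in the null set where `g` does not vanish, yet its measure is `r ^ n`
  -- times the positive measure of `s`.
  have hzero : (μHE[n] : Measure V) (AffineMap.homothety x r '' s) = 0 := by
    have h1 : ∀ᵐ y ∂(μHE[n] : Measure V), y ∈ s → g y = 0 := by
      rwa [Filter.EventuallyEq, ae_restrict_iff' hms] at hgi
    refine measure_mono_null (fun y hy => ?_) h1
    intro hcon
    exact hball (hsub hy) (hcon (hsub hy).2)
  rw [euclideanHausdorffMeasure_homothety_image n x hr0.ne'] at hzero
  rw [ENNReal.smul_def, smul_eq_mul, mul_eq_zero] at hzero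
  rcases hzero with h | h
  · exact hr0.ne' (by simpa using eq_zero_of_pow_eq_zero (ENNReal.coe_eq_zero.1 h))
  · exact hpos.ne' h

end ConvexMeasure

/-! ### Simplices and affine functions on them -/

variable {d : ℕ}

theorem isCompact_simplex (s : Finset (E d)) : IsCompact (simplex s) :=
  s.finite_toSet.isCompact_convexHull ℝ

theorem measurableSet_simplex (s : Finset (E d)) : MeasurableSet (simplex s) :=
  (isCompact_simplex s).isClosed.measurableSet

theorem convex_simplex (s : Finset (E d)) : Convex ℝ (simplex s) := convex_convexHull ℝ _

theorem subset_simplex (s : Finset (E d)) : (s : Set (E d)) ⊆ simplex s := subset_convexHull ℝ _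

theorem simplex_mono {s t : Finset (E d)} (h : s ⊆ t) : simplex s ⊆ simplex t :=
  convexHull_mono (Finset.coe_subset.2 h)

theorem finrank_vectorSpan_simplex {F : Finset (E d)} (hF : AffineIndependent ℝ ((↑) : F → E d))
    (hcard : F.card = d) (hd : 0 < d) : finrank ℝ (vectorSpan ℝ (simplex F)) = d - 1 := by
  have h := hF.finrank_vectorSpan (n := d - 1) (by simp; omega)
  rw [simplex, ← direction_affineSpan, affineSpan_convexHull, direction_affineSpan]
  have hr : range ((↑) : F → E d) = F := by ext; simp
  rwa [hr] at h

/-- The affine basis formed by the vertices of an affinely independent set of `d + 1` points. -/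
def vertexBasis (K : Finset (E d)) (hK : AffineIndependent ℝ ((↑) : K → E d))
    (hcard : K.card = d + 1) : AffineBasis K ℝ (E d) :=
  ⟨(↑), hK, hK.affineSpan_eq_top_iff_card_eq_finrank_add_one.2 (by simp [hcard])⟩

@[simp]
theorem vertexBasis_apply {K : Finset (E d)} (hK : AffineIndependent ℝ ((↑) : K → E d))
    (hcard : K.card = d + 1) (v : K) : vertexBasis K hK hcard v = v := rfl

theorem mem_simplex_iff_coord_nonneg {K : Finset (E d)}
    (hK : AffineIndependent ℝ ((↑) : K → E d)) (hcard : K.card = d + 1) {x : E d} :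
    x ∈ simplex K ↔ ∀ v, 0 ≤ (vertexBasis K hK hcard).coord v x := by
  have h := (vertexBasis K hK hcard).convexHull_eq_nonneg_coord
  have h2 : range (vertexBasis K hK hcard) = (K : Set (E d)) := by
    ext; simp
  rw [h2] at h
  rw [simplex, h]; rfl

theorem interior_simplex_nonempty {K : Finset (E d)}
    (hK : AffineIndependent ℝ ((↑) : K → E d)) (hcard : K.card = d + 1) :
    (interior (simplex K)).Nonempty :=
  interior_convexHull_nonempty_iff_affineSpan_eq_top.2
    (by simpa using hK.affineSpan_eq_top_iff_card_eq_finrank_add_one.2 (by simp [hcard]))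

theorem uniqueDiffOn_simplex {K : Finset (E d)}
    (hK : AffineIndependent ℝ ((↑) : K → E d)) (hcard : K.card = d + 1) :
    UniqueDiffOn ℝ (simplex K) :=
  uniqueDiffOn_convex (convex_simplex K) (interior_simplex_nonempty hK hcard)

theorem diam_pos_of_one_lt_card {s : Finset (E d)} (h : 1 < s.card) : 0 < diam s := by
  obtain ⟨x, hx, y, hy, hxy⟩ := Finset.one_lt_card.1 h
  exact (dist_pos.2 hxy).trans_le (Metric.dist_le_diam_of_mem (isCompact_simplex s).isBounded
    (subset_simplex s hx) (subset_simplex s hy))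

/-- A monomial of degree at most one is a constant or a multiple of one coordinate, and the
functions of the required form are closed under sums. -/
theorem exists_eval_eq_inner_add (p : MvPolynomial (Fin d) ℝ) (hp : p.totalDegree ≤ 1) :
    ∃ (g : E d) (b : ℝ), ∀ x : E d, MvPolynomial.eval (fun i => x i) p = ⟪g, x⟫_ℝ + b := by
  suffices h : ∃ (g : E d) (b : ℝ), (fun x : E d => MvPolynomial.eval (fun i => x i) p) =
      fun x => ⟪g, x⟫_ℝ + b by
    obtain ⟨g, b, h⟩ := h
    exact ⟨g, b, fun x => congrFun h x⟩
  have hsum : (fun x : E d => MvPolynomial.eval (fun i => x i) p) =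
      ∑ m ∈ p.support, fun x : E d => p.coeff m * ∏ i, x i ^ m i := by
    funext x
    rw [MvPolynomial.eval_eq', Finset.sum_apply]
  rw [hsum]
  refine Finset.sum_induction _
    (fun φ : E d → ℝ => ∃ (g : E d) (b : ℝ), φ = fun x => ⟪g, x⟫_ℝ + b) ?_ ?_ ?_
  · rintro _ _ ⟨g, b, rfl⟩ ⟨g', b', rfl⟩
    exact ⟨g + g', b + b', by funext x; simp only [Pi.add_apply, inner_add_left]; ring⟩
  · exact ⟨0, 0, by funext x; simp⟩
  · intro m hm
    have hdeg : ∑ i, m i ≤ 1 := by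
      have := (MvPolynomial.le_totalDegree hm).trans hp
      rwa [Finsupp.sum_fintype _ _ (fun _ => rfl)] at this
    by_cases h0 : ∀ i, m i = 0
    · exact ⟨0, p.coeff m, by funext x; simp [h0]⟩
    · push Not at h0
      obtain ⟨i, hi⟩ := h0
      have hi1 : m i = 1 := by
        have := Finset.single_le_sum (f := fun i => m i) (fun _ _ => Nat.zero_le _)
          (Finset.mem_univ i)
        omega
      have hj : ∀ j, j ≠ i → m j = 0 := by
        intro j hji
        have := Finset.add_le_sum (f := fun i => m i) (fun _ _ => Nat.zero_le _)
          (Finset.mem_univ i) (Finset.mem_univ j) hji.symm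
        omega
      refine ⟨p.coeff m • EuclideanSpace.single i 1, 0, ?_⟩
      funext x
      rw [Finset.prod_eq_single i (fun j _ hji => by simp [hj j hji]) (by simp), hi1,
        real_inner_smul_left, EuclideanSpace.inner_single_left]
      simp

/-! ### Derivatives on a closed element -/

section AffineOnElement

variable {K : Finset (E d)} {u : E d → ℝ} {g : E d} {b : ℝ}

/-- Unique differentiability also holds at boundary points, so the values on the closed simplex
alone determine the derivative there; this is what makes one-sided traces of the gradient on faces
meaningful. -/
theorem fderivWithin_of_affineOn (hK : UniqueDiffOn ℝ (simplex K))
    (hu : ∀ x ∈ simplex K, u x = ⟪g, x⟫_ℝ + b) {x : E d} (hx : x ∈ simplex K) :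
    fderivWithin ℝ u (simplex K) x = innerSL ℝ g := by
  have h : HasFDerivWithinAt (fun x => ⟪g, x⟫_ℝ + b) (innerSL ℝ g) (simplex K) x :=
    ((innerSL ℝ g).hasFDerivWithinAt).add_const b
  exact (h.congr hu (hu x hx)).fderivWithin (hK x hx)

theorem gradOn_of_affineOn (hK : UniqueDiffOn ℝ (simplex K))
    (hu : ∀ x ∈ simplex K, u x = ⟪g, x⟫_ℝ + b) {x : E d} (hx : x ∈ simplex K) :
    gradOn K u x = g := by
  rw [gradOn, gradientWithin, fderivWithin_of_affineOn hK hu hx]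
  exact (InnerProductSpace.toDual ℝ (E d)).symm_apply_apply g

/-- The first derivative is constant on the whole closed simplex, so the second one vanishes up to
the boundary. -/
theorem lapOn_of_affineOn (hK : UniqueDiffOn ℝ (simplex K))
    (hu : ∀ x ∈ simplex K, u x = ⟪g, x⟫_ℝ + b) {x : E d} (hx : x ∈ simplex K) :
    lapOn K u x = 0 := by
  rw [lapOn, InnerProductSpace.laplacianWithin_eq_iteratedFDerivWithin_stdOrthonormalBasis u hK hx]
  refine Finset.sum_eq_zero fun i _ => ?_
  rw [iteratedFDerivWithin_two_apply u hK hx,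
    fderivWithin_congr (fun y hy => fderivWithin_of_affineOn hK hu hy)
      (fderivWithin_of_affineOn hK hu hx)]
  simp

end AffineOnElement

theorem continuousOn_gradOn {K : Finset (E d)} (hK : UniqueDiffOn ℝ (simplex K)) {u : E d → ℝ}
    (hu : ContDiffOn ℝ 2 u (simplex K)) : ContinuousOn (gradOn K u) (simplex K) :=
  (InnerProductSpace.toDual ℝ (E d)).symm.continuous.comp_continuousOn
    (hu.continuousOn_fderivWithin hK (by norm_num))

theorem continuousOn_divOn {K : Finset (E d)} (hK : UniqueDiffOn ℝ (simplex K)) {g : E d → E d}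
    (hg : ContDiffOn ℝ 2 g (simplex K)) : ContinuousOn (divOn K g) (simplex K) := by
  have h := hg.continuousOn_fderivWithin hK (by norm_num)
  refine continuousOn_finsetSum _ fun i _ => ?_
  have h2 := h.clm_apply (continuousOn_const (c := EuclideanSpace.single i (1 : ℝ)))
  exact (EuclideanSpace.proj (𝕜 := ℝ) i).continuous.comp_continuousOn h2

/-! ### The piecewise affine finite element space -/

namespace Triangulation

variable (T : Triangulation d)

theorem mem_elements {K : Finset (E d)} :
    K ∈ T.elements ↔ K ∈ T.complex.faces ∧ K.card = d + 1 := by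
  simp [elements]

theorem mem_elementsAt {F K : Finset (E d)} :
    K ∈ T.elementsAt F ↔ K ∈ T.elements ∧ F ⊆ K := by
  simp [elementsAt]

theorem mem_interiorFaces {F : Finset (E d)} :
    F ∈ T.interiorFaces ↔ F ∈ T.complex.faces ∧ F.card = d ∧ (T.elementsAt F).card = 2 := by
  simp [interiorFaces]

theorem mem_boundaryFaces {F : Finset (E d)} :
    F ∈ T.boundaryFaces ↔ F ∈ T.complex.faces ∧ F.card = d ∧ (T.elementsAt F).card = 1 := by
  simp [boundaryFaces]

variable {T}

theorem simplex_subset_closedDomain {s : Finset (E d)} (hs : s ∈ T.complex.faces) :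
    simplex s ⊆ T.closedDomain :=
  T.complex.convexHull_subset_space hs

theorem uniqueDiffOn_element {K : Finset (E d)} (hK : K ∈ T.elements) :
    UniqueDiffOn ℝ (simplex K) :=
  uniqueDiffOn_simplex (T.complex.indep (T.mem_elements.1 hK).1) (T.mem_elements.1 hK).2

theorem exists_element_of_mem_closedDomain {x : E d} (hx : x ∈ T.closedDomain) :
    ∃ K ∈ T.elements, x ∈ simplex K := by
  obtain ⟨s, hs, hxs⟩ := Geometry.SimplicialComplex.mem_space_iff.1 hx
  obtain ⟨t, ht, hst, hcard⟩ := T.pure s hs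
  exact ⟨t, T.mem_elements.2 ⟨ht, hcard⟩, simplex_mono hst hxs⟩

variable (T) in
theorem isCompact_closedDomain : IsCompact T.closedDomain :=
  T.finite.isCompact_biUnion fun s _ => isCompact_simplex s

/-- A finite element function of degree one is affine on each element. -/
theorem exists_affineOn (v : T.feSpace 1) {K : Finset (E d)} (hK : K ∈ T.elements) :
    ∃ (g : E d) (b : ℝ), ∀ x ∈ simplex K, v.1 x = ⟪g, x⟫_ℝ + b := by
  obtain ⟨p, hp, hpe⟩ := v.2.2.2 K hK
  obtain ⟨g, b, h⟩ := exists_eval_eq_inner_add p hp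
  exact ⟨g, b, fun x hx => (hpe x hx).trans (h x)⟩

theorem contDiffOn_feSpace (v : T.feSpace 1) {K : Finset (E d)} (hK : K ∈ T.elements) :
    ContDiffOn ℝ 2 v.1 (simplex K) := by
  obtain ⟨g, b, h⟩ := exists_affineOn v hK
  refine ContDiffOn.congr ?_ h
  exact ((innerSL ℝ g).contDiff.add contDiff_const).contDiffOn

theorem lapOn_feSpace (v : T.feSpace 1) {K : Finset (E d)} (hK : K ∈ T.elements) {x : E d}
    (hx : x ∈ simplex K) : lapOn K v.1 x = 0 := by
  obtain ⟨g, b, h⟩ := exists_affineOn v hK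
  exact lapOn_of_affineOn (uniqueDiffOn_element hK) h hx

/-- A piecewise affine function is determined by its nodal values, so evaluation at the vertices of
all faces embeds the space into a finite product. -/
instance : FiniteDimensional ℝ (T.feSpace 1) := by
  have hfin : Finite T.complex.faces := T.finite
  let φ : T.feSpace 1 →ₗ[ℝ] ((s : T.complex.faces) → s.1 → ℝ) :=
    { toFun := fun v s x => v.1 x
      map_add' := fun _ _ => rfl
      map_smul' := fun _ _ => rfl }
  refine FiniteDimensional.of_injective φ ?_
  rw [← LinearMap.ker_eq_bot, LinearMap.ker_eq_bot']
  intro v hv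
  apply Subtype.ext
  funext x
  by_cases hx : x ∈ T.closedDomain
  · obtain ⟨K, hK, hxK⟩ := exists_element_of_mem_closedDomain hx
    obtain ⟨g, b, h⟩ := exists_affineOn v hK
    have hconv : Convex ℝ {y : E d | ⟪g, y⟫_ℝ = -b} := convex_hyperplane (innerₛₗ ℝ g).isLinear _
    -- The zero set of the affine representative is convex and contains the vertices, hence the
    -- whole simplex.
    have hsub : simplex K ⊆ {y : E d | ⟪g, y⟫_ℝ = -b} := by
      refine convexHull_min (fun y hy => ?_) hconv
      have h1 : v.1 y = 0 := congrFun (congrFun hv ⟨K, (T.mem_elements.1 hK).1⟩) ⟨y, hy⟩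
      have h2 := h y (subset_simplex K hy)
      simp only [mem_ofPred_eq]; linarith
    have h3 : ⟪g, x⟫_ℝ = -b := hsub hxK
    rw [h x hxK, h3]; simp
  · exact v.2.1 x hx

theorem isLinearMap_gradOn {K : Finset (E d)} (hK : K ∈ T.elements) {x : E d}
    (hx : x ∈ simplex K) : IsLinearMap ℝ fun v : T.feSpace 1 => gradOn K v.1 x := by
  constructor
  · intro v w
    obtain ⟨g, b, h⟩ := exists_affineOn v hK
    obtain ⟨g', b', h'⟩ := exists_affineOn w hK
    rw [gradOn_of_affineOn (uniqueDiffOn_element hK) h hx,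
      gradOn_of_affineOn (uniqueDiffOn_element hK) h' hx]
    refine gradOn_of_affineOn (b := b + b') (uniqueDiffOn_element hK) (fun y hy => ?_) hx
    simp only [Submodule.coe_add, Pi.add_apply, h y hy, h' y hy, inner_add_left]; ring
  · intro r v
    obtain ⟨g, b, h⟩ := exists_affineOn v hK
    rw [gradOn_of_affineOn (uniqueDiffOn_element hK) h hx]
    refine gradOn_of_affineOn (b := r * b) (uniqueDiffOn_element hK) (fun y hy => ?_) hx
    simp only [Submodule.coe_smul, Pi.smul_apply, h y hy, real_inner_smul_left, smul_eq_mul]; ring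

theorem isLinearMap_divOn {K : Finset (E d)} (hK : K ∈ T.elements) {β : E d → E d}
    (hβ : ContDiffOn ℝ 2 β (simplex K)) {x : E d} (hx : x ∈ simplex K) :
    IsLinearMap ℝ fun v : T.feSpace 1 => divOn K (fun y => v.1 y • β y) x := by
  have hdiff (v : T.feSpace 1) :
      DifferentiableWithinAt ℝ (fun y => v.1 y • β y) (simplex K) x :=
    (((contDiffOn_feSpace v hK).smul hβ).differentiableOn (by norm_num)) x hx
  have hu := uniqueDiffOn_element hK x hx
  constructor
  · intro v w
    have h : (fun y => (v + w).1 y • β y) = (fun y => v.1 y • β y) + fun y => w.1 y • β y := by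
      funext y; simp [add_smul]
    simp only [divOn, h, fderivWithin_add hu (hdiff v) (hdiff w), ← Finset.sum_add_distrib]
    rfl
  · intro r v
    have h : (fun y => (r • v).1 y • β y) = r • fun y => v.1 y • β y := by
      funext y; simp [mul_smul]
    simp only [divOn, h, fderivWithin_const_smul hu (hdiff v), smul_eq_mul, Finset.mul_sum]
    rfl

end Triangulation

/-! ### Closure properties of bilinear maps -/

section Bilinear

variable {V : Type*} [AddCommGroup V] [Module ℝ V] {b b' : V → V → ℝ}

theorem isBilinearMap_add (h : IsBilinearMap ℝ b) (h' : IsBilinearMap ℝ b') :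
    IsBilinearMap ℝ fun u v => b u v + b' u v where
  add_left u v w := by rw [h.add_left, h'.add_left]; ring
  smul_left r u v := by simp only [h.smul_left, h'.smul_left, smul_eq_mul]; ring
  add_right u v w := by rw [h.add_right, h'.add_right]; ring
  smul_right r u v := by simp only [h.smul_right, h'.smul_right, smul_eq_mul]; ring

theorem isBilinearMap_const_mul (r : ℝ) (h : IsBilinearMap ℝ b) :
    IsBilinearMap ℝ fun u v => r * b u v where
  add_left u v w := by rw [h.add_left]; ring
  smul_left r u v := by simp only [h.smul_left, smul_eq_mul]; ring
  add_right u v w := by rw [h.add_right]; ring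
  smul_right r u v := by simp only [h.smul_right, smul_eq_mul]; ring

theorem isBilinearMap_sub (h : IsBilinearMap ℝ b) (h' : IsBilinearMap ℝ b') :
    IsBilinearMap ℝ fun u v => b u v - b' u v where
  add_left u v w := by rw [h.add_left, h'.add_left]; ring
  smul_left r u v := by simp only [h.smul_left, h'.smul_left, smul_eq_mul]; ring
  add_right u v w := by rw [h.add_right, h'.add_right]; ring
  smul_right r u v := by simp only [h.smul_right, h'.smul_right, smul_eq_mul]; ring

theorem isBilinearMap_flip (h : IsBilinearMap ℝ b) : IsBilinearMap ℝ fun u v => b v u where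
  add_left _ _ _ := h.add_right _ _ _
  smul_left _ _ _ := h.smul_right _ _ _
  add_right _ _ _ := h.add_left _ _ _
  smul_right _ _ _ := h.smul_left _ _ _

theorem isBilinearMap_sum {ι : Type*} (s : Finset ι) {b : ι → V → V → ℝ}
    (h : ∀ i ∈ s, IsBilinearMap ℝ (b i)) : IsBilinearMap ℝ fun u v => ∑ i ∈ s, b i u v where
  add_left u v w := by
    rw [← Finset.sum_add_distrib]
    exact Finset.sum_congr rfl fun i hi => (h i hi).add_left _ _ _
  smul_left r u v := by
    rw [Finset.smul_sum]
    exact Finset.sum_congr rfl fun i hi => (h i hi).smul_left _ _ _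
  add_right u v w := by
    rw [← Finset.sum_add_distrib]
    exact Finset.sum_congr rfl fun i hi => (h i hi).add_right _ _ _
  smul_right r u v := by
    rw [Finset.smul_sum]
    exact Finset.sum_congr rfl fun i hi => (h i hi).smul_right _ _ _

theorem isBilinearMap_mul {l m : V → ℝ} (hl : IsLinearMap ℝ l) (hm : IsLinearMap ℝ m) :
    IsBilinearMap ℝ fun u v => l u * m v where
  add_left u v w := by rw [hl.map_add]; ring
  smul_left r u v := by simp only [hl.map_smul, smul_eq_mul]; ring
  add_right u v w := by rw [hm.map_add]; ring
  smul_right r u v := by simp only [hm.map_smul, smul_eq_mul]; ring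

theorem isBilinearMap_inner {W : Type*} [NormedAddCommGroup W] [InnerProductSpace ℝ W]
    {l m : V → W} (hl : IsLinearMap ℝ l) (hm : IsLinearMap ℝ m) :
    IsBilinearMap ℝ fun u v => ⟪l u, m v⟫_ℝ where
  add_left u v w := by rw [hl.map_add, inner_add_left]
  smul_left r u v := by simp only [hl.map_smul, smul_eq_mul, real_inner_smul_left]
  add_right u v w := by rw [hm.map_add, inner_add_right]
  smul_right r u v := by simp only [hm.map_smul, smul_eq_mul, real_inner_smul_right]

theorem isBilinearMap_setIntegral {X : Type*} [MeasurableSpace X] {ν : Measure X} {s : Set X}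
    (hs : MeasurableSet s) {φ : V → V → X → ℝ}
    (hφ : ∀ x ∈ s, IsBilinearMap ℝ fun u v => φ u v x)
    (hi : ∀ u v, IntegrableOn (φ u v) s ν) :
    IsBilinearMap ℝ fun u v => ∫ x in s, φ u v x ∂ν where
  add_left u v w := by
    rw [← integral_add (hi _ _) (hi _ _)]
    exact setIntegral_congr_fun hs fun x hx => (hφ x hx).add_left _ _ _
  smul_left r u v := by
    rw [← integral_smul]
    exact setIntegral_congr_fun hs fun x hx => (hφ x hx).smul_left _ _ _
  add_right u v w := by
    rw [← integral_add (hi _ _) (hi _ _)]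
    exact setIntegral_congr_fun hs fun x hx => (hφ x hx).add_right _ _ _
  smul_right r u v := by
    rw [← integral_smul]
    exact setIntegral_congr_fun hs fun x hx => (hφ x hx).smul_right _ _ _

end Bilinear

theorem continuous_negPart : Continuous neg := by unfold neg; fun_prop

theorem continuous_posPart : Continuous pos := by unfold pos; fun_prop

/-! ### Bilinearity of the discrete forms -/

namespace Triangulation

variable {T : Triangulation d}

theorem isLinearMap_eval (x : E d) : IsLinearMap ℝ fun v : T.feSpace 1 => v.1 x :=
  ⟨fun _ _ => rfl, fun _ _ => rfl⟩

theorem isLinearMap_gradOn_inner {K : Finset (E d)} (hK : K ∈ T.elements) {x : E d}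
    (hx : x ∈ simplex K) (n : E d) :
    IsLinearMap ℝ fun v : T.feSpace 1 => ⟪gradOn K v.1 x, n⟫_ℝ := by
  have h := isLinearMap_gradOn hK hx
  exact ⟨fun v w => by rw [h.map_add, inner_add_left],
    fun r v => by rw [h.map_smul, real_inner_smul_left, smul_eq_mul]⟩

/-- Integrability over a face of dimension `d - 1`. -/
theorem integrableOn_face (hd : 0 < d) {F : Finset (E d)} (hF : F ∈ T.complex.faces)
    (hcard : F.card = d) {g : E d → ℝ} (hg : ContinuousOn g (simplex F)) :
    IntegrableOn g (simplex F) (μHE[d - 1] : Measure (E d)) :=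
  integrableOn_euclideanHausdorffMeasure_convex (convex_simplex F) (isCompact_simplex F)
    (finrank_vectorSpan_simplex (T.complex.indep hF) hcard hd) hg

theorem eq_zero_of_faceIntegral_eq_zero (hd : 0 < d) {F : Finset (E d)}
    (hF : F ∈ T.complex.faces) (hcard : F.card = d) {g : E d → ℝ}
    (hg : ContinuousOn g (simplex F)) (hg0 : ∀ x ∈ simplex F, 0 ≤ g x)
    (hgi : faceIntegral F g = 0) {x : E d} (hx : x ∈ simplex F) : g x = 0 :=
  eq_zero_of_setIntegral_euclideanHausdorffMeasure_eq_zero (convex_simplex F)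
    (isCompact_simplex F) (finrank_vectorSpan_simplex (T.complex.indep hF) hcard hd) hg hg0 hgi hx

theorem faceIntegral_nonneg {F : Finset (E d)} {g : E d → ℝ} (hg0 : ∀ x ∈ simplex F, 0 ≤ g x) :
    0 ≤ faceIntegral F g :=
  setIntegral_nonneg (measurableSet_simplex F) hg0

variable (T) in
theorem isBilinearMap_boundaryIntegral (hd : 0 < d)
    {φ : T.feSpace 1 → T.feSpace 1 → Finset (E d) → Finset (E d) → E d → ℝ}
    (hφ : ∀ F, ∀ K ∈ T.elements, ∀ x ∈ simplex K, IsBilinearMap ℝ fun u v => φ u v K F x)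
    (hc : ∀ u v, ∀ F, ∀ K ∈ T.elements, ContinuousOn (φ u v K F) (simplex K)) :
    IsBilinearMap ℝ fun u v => T.boundaryIntegral (φ u v) := by
  refine isBilinearMap_sum _ fun F hF => isBilinearMap_sum _ fun K hK => ?_
  obtain ⟨hF, hcard, -⟩ := T.mem_boundaryFaces.1 hF
  obtain ⟨hK, hFK⟩ := T.mem_elementsAt.1 hK
  exact isBilinearMap_setIntegral (measurableSet_simplex F)
    (fun x hx => hφ F K hK x (simplex_mono hFK hx))
    fun u v => integrableOn_face hd hF hcard ((hc u v F K hK).mono (simplex_mono hFK))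

variable {μ θ : ℝ} {β : E d → E d} {c : E d → ℝ} {γ₁ γ₂ : Finset (E d) → ℝ}

theorem continuousOn_feSpace (v : T.feSpace 1) {K : Finset (E d)} (hK : K ∈ T.elements) :
    ContinuousOn v.1 (simplex K) := (contDiffOn_feSpace v hK).continuousOn

theorem continuousOn_gradOn_feSpace (v : T.feSpace 1) {K : Finset (E d)} (hK : K ∈ T.elements) :
    ContinuousOn (gradOn K v.1) (simplex K) :=
  continuousOn_gradOn (uniqueDiffOn_element hK) (contDiffOn_feSpace v hK)

theorem element_subset_closedDomain {K : Finset (E d)} (hK : K ∈ T.elements) :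
    simplex K ⊆ T.closedDomain :=
  simplex_subset_closedDomain (T.mem_elements.1 hK).1

theorem isBilinearMap_a (hβ : ContDiffOn ℝ 2 β T.closedDomain)
    (hc : ContDiffOn ℝ 1 c T.closedDomain) :
    IsBilinearMap ℝ fun u v : T.feSpace 1 => T.a μ β c u v := by
  refine isBilinearMap_add (isBilinearMap_sum _ fun K hK => ?_)
    (isBilinearMap_sum _ fun K hK => ?_)
  · refine isBilinearMap_setIntegral (measurableSet_simplex K) (fun x hx =>
      isBilinearMap_const_mul _ (isBilinearMap_inner (isLinearMap_gradOn hK hx)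
        (isLinearMap_gradOn hK hx))) fun u v => ?_
    exact (continuousOn_const.mul ((continuousOn_gradOn_feSpace u hK).inner
      (continuousOn_gradOn_feSpace v hK))).integrableOn_compact (isCompact_simplex K)
  · have hsub := element_subset_closedDomain hK
    have hβK := hβ.mono hsub
    refine isBilinearMap_setIntegral (measurableSet_simplex K) (fun x hx =>
      isBilinearMap_mul ?_ (isLinearMap_eval x)) fun u v => ?_
    · have h := isLinearMap_divOn hK hβK hx
      refine ⟨fun u v => ?_, fun r u => ?_⟩
      · rw [h.map_add, (isLinearMap_eval x).map_add]; ring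
      · rw [h.map_smul, (isLinearMap_eval x).map_smul]; simp only [smul_eq_mul]; ring
    · exact (((continuousOn_divOn (uniqueDiffOn_element hK)
        ((contDiffOn_feSpace u hK).smul hβK)).add ((hc.continuousOn.mono hsub).mul
          (continuousOn_feSpace u hK))).mul (continuousOn_feSpace v hK)).integrableOn_compact
          (isCompact_simplex K)

theorem isBilinearMap_weightedMass (w : Finset (E d) → Finset (E d) → E d → ℝ) (hd : 0 < d)
    (hw : ∀ F, ∀ K ∈ T.elements, ContinuousOn (w K F) (simplex K)) :
    IsBilinearMap ℝ fun u v : T.feSpace 1 =>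
      T.boundaryIntegral (fun K F x => w K F x * u.1 x * v.1 x) := by
  refine T.isBilinearMap_boundaryIntegral hd (fun F K hK x hx => ?_) fun u v F K hK =>
    ((hw F K hK).mul (continuousOn_feSpace u hK)).mul (continuousOn_feSpace v hK)
  simp only [mul_assoc]
  exact isBilinearMap_const_mul _ (isBilinearMap_mul (isLinearMap_eval x) (isLinearMap_eval x))

theorem continuousOn_normalComponent (hβ : ContinuousOn β T.closedDomain) {K : Finset (E d)}
    (hK : K ∈ T.elements) (n : E d) : ContinuousOn (fun x => ⟪β x, n⟫_ℝ) (simplex K) :=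
  (hβ.mono (element_subset_closedDomain hK)).inner continuousOn_const

theorem isBilinearMap_ah (hd : 0 < d) (hβ : ContDiffOn ℝ 2 β T.closedDomain)
    (hc : ContDiffOn ℝ 1 c T.closedDomain) :
    IsBilinearMap ℝ fun u v : T.feSpace 1 => T.ah μ β c θ u v := by
  have hflux : IsBilinearMap ℝ fun u v : T.feSpace 1 =>
      T.boundaryIntegral (fun K F x => ⟪gradOn K u.1 x, normal K F⟫_ℝ * v.1 x) :=
    T.isBilinearMap_boundaryIntegral hd (fun F K hK x hx =>
      isBilinearMap_mul (isLinearMap_gradOn_inner hK hx _) (isLinearMap_eval x)) fun u v F K hK =>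
        ((continuousOn_gradOn_feSpace u hK).inner continuousOn_const).mul
          (continuousOn_feSpace v hK)
  exact isBilinearMap_sub (isBilinearMap_sub (isBilinearMap_sub (isBilinearMap_a hβ hc)
    (isBilinearMap_const_mul θ hflux)) (isBilinearMap_const_mul θ (isBilinearMap_flip hflux)))
    (isBilinearMap_weightedMass _ hd fun _ _ hK =>
      continuous_negPart.comp_continuousOn (continuousOn_normalComponent hβ.continuousOn hK _))

theorem isBilinearMap_sbc (hd : 0 < d) (hβ : ContinuousOn β T.closedDomain) {σ : ℝ → ℝ}
    (hσ : Continuous σ) : IsBilinearMap ℝ fun u v : T.feSpace 1 => T.sbc σ μ β u v :=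
  isBilinearMap_add
    (isBilinearMap_weightedMass (fun _ _ _ => μ * T.meshSize⁻¹) hd
      fun _ _ _ => continuousOn_const)
    (isBilinearMap_weightedMass _ hd fun _ _ hK =>
      (hσ.comp_continuousOn (continuousOn_normalComponent hβ hK _)).abs)

/-- On continuous piecewise affine test functions the jumps of the Laplacians vanish. -/
theorem scip_feSpace (u : E d → ℝ) (v : T.feSpace 1) :
    T.scip γ₁ γ₂ u v = ∑ F ∈ T.interiorFaces, faceIntegral F fun x =>
      diam F * γ₁ F * T.gradJumpProd F u v x := by
  refine Finset.sum_congr rfl fun F hF => ?_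
  refine setIntegral_congr_fun (measurableSet_simplex F) fun x hx => ?_
  -- One vanishing factor is enough, so `u` may be arbitrary here; this covers the data term `s_p(u,
  -- ·)` as well.
  have h : T.lapJumpProd F u v x = 0 := by
    rw [lapJumpProd]
    refine mul_eq_zero_of_right _ (Finset.sum_eq_zero fun K hK => Finset.sum_eq_zero
      fun K' hK' => ?_)
    obtain ⟨hK, hFK⟩ := T.mem_elementsAt.1 hK
    obtain ⟨hK', hFK'⟩ := T.mem_elementsAt.1 hK'
    rw [lapOn_feSpace v hK (simplex_mono hFK hx), lapOn_feSpace v hK' (simplex_mono hFK' hx)]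
    simp
  simp [h]

theorem continuousOn_gradJumpProd {F : Finset (E d)} {u v : E d → ℝ}
    (hu : ∀ K ∈ T.elements, ContinuousOn (gradOn K u) (simplex K))
    (hv : ∀ K ∈ T.elements, ContinuousOn (gradOn K v) (simplex K)) :
    ContinuousOn (T.gradJumpProd F u v) (simplex F) := by
  refine continuousOn_const.mul (continuousOn_finsetSum _ fun K hK =>
    continuousOn_finsetSum _ fun K' hK' => ?_)
  obtain ⟨hK, hFK⟩ := T.mem_elementsAt.1 hK
  obtain ⟨hK', hFK'⟩ := T.mem_elementsAt.1 hK'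
  have h1 := simplex_mono hFK
  have h2 := simplex_mono hFK'
  exact (((hu K hK).mono h1).sub ((hu K' hK').mono h2)).inner
    (((hv K hK).mono h1).sub ((hv K' hK').mono h2))

theorem isLinearMap_jump {F K K' : Finset (E d)} (hK : K ∈ T.elementsAt F)
    (hK' : K' ∈ T.elementsAt F) {x : E d} (hx : x ∈ simplex F) :
    IsLinearMap ℝ fun v : T.feSpace 1 => gradOn K v.1 x - gradOn K' v.1 x := by
  obtain ⟨hK, hFK⟩ := T.mem_elementsAt.1 hK
  obtain ⟨hK', hFK'⟩ := T.mem_elementsAt.1 hK'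
  have h := isLinearMap_gradOn hK (simplex_mono hFK hx)
  have h' := isLinearMap_gradOn hK' (simplex_mono hFK' hx)
  exact ⟨fun v w => by rw [h.map_add, h'.map_add]; abel,
    fun r v => by rw [h.map_smul, h'.map_smul, smul_sub]⟩

theorem isBilinearMap_scip (hd : 0 < d) :
    IsBilinearMap ℝ fun u v : T.feSpace 1 => T.scip γ₁ γ₂ u v := by
  simp only [scip_feSpace]
  refine isBilinearMap_sum _ fun F hF => ?_
  obtain ⟨hF, hcard, -⟩ := T.mem_interiorFaces.1 hF
  refine isBilinearMap_setIntegral (measurableSet_simplex F) (fun x hx =>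
    isBilinearMap_const_mul _ (isBilinearMap_const_mul _ (isBilinearMap_sum _ fun K hK =>
      isBilinearMap_sum _ fun K' hK' => isBilinearMap_inner (isLinearMap_jump hK hK' hx)
        (isLinearMap_jump hK hK' hx)))) fun u v => ?_
  exact integrableOn_face hd hF hcard (continuousOn_const.mul (continuousOn_gradJumpProd
    (fun K hK => continuousOn_gradOn_feSpace u hK) fun K hK => continuousOn_gradOn_feSpace v hK))

theorem isBilinearMap_sp (hd : 0 < d) (hβ : ContinuousOn β T.closedDomain) :
    IsBilinearMap ℝ fun u v : T.feSpace 1 => T.sp μ β γ₁ γ₂ u v :=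
  isBilinearMap_add (isBilinearMap_scip hd) (isBilinearMap_sbc hd hβ continuous_negPart)

theorem isBilinearMap_sa (hd : 0 < d) (hβ : ContinuousOn β T.closedDomain) :
    IsBilinearMap ℝ fun u v : T.feSpace 1 => T.sa μ β γ₁ γ₂ u v :=
  isBilinearMap_add (isBilinearMap_scip hd) (isBilinearMap_sbc hd hβ continuous_posPart)

/-! ### Linearity of the right-hand sides -/

section LinearFunctionals

variable {V : Type*} [AddCommGroup V] [Module ℝ V]

theorem isLinearMap_sum {ι : Type*} (s : Finset ι) {l : ι → V → ℝ}
    (h : ∀ i ∈ s, IsLinearMap ℝ (l i)) : IsLinearMap ℝ fun v => ∑ i ∈ s, l i v where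
  map_add u v := by
    rw [← Finset.sum_add_distrib]
    exact Finset.sum_congr rfl fun i hi => (h i hi).map_add _ _
  map_smul r u := by
    rw [Finset.smul_sum]
    exact Finset.sum_congr rfl fun i hi => (h i hi).map_smul _ _

theorem isLinearMap_add {l m : V → ℝ} (hl : IsLinearMap ℝ l) (hm : IsLinearMap ℝ m) :
    IsLinearMap ℝ fun v => l v + m v where
  map_add u v := by rw [hl.map_add, hm.map_add]; ring
  map_smul r u := by simp only [hl.map_smul, hm.map_smul, smul_eq_mul]; ring

theorem isLinearMap_const_mul (r : ℝ) {l : V → ℝ} (hl : IsLinearMap ℝ l) :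
    IsLinearMap ℝ fun v => r * l v where
  map_add u v := by rw [hl.map_add]; ring
  map_smul r u := by simp only [hl.map_smul, smul_eq_mul]; ring

theorem isLinearMap_inner_right {W : Type*} [NormedAddCommGroup W] [InnerProductSpace ℝ W]
    (w : W) {l : V → W} (hl : IsLinearMap ℝ l) : IsLinearMap ℝ fun v => ⟪w, l v⟫_ℝ where
  map_add u v := by rw [hl.map_add, inner_add_right]
  map_smul r u := by rw [hl.map_smul, real_inner_smul_right, smul_eq_mul]

theorem isLinearMap_setIntegral {X : Type*} [MeasurableSpace X] {ν : Measure X} {s : Set X}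
    (hs : MeasurableSet s) {φ : V → X → ℝ} (hφ : ∀ x ∈ s, IsLinearMap ℝ fun u => φ u x)
    (hi : ∀ u, IntegrableOn (φ u) s ν) : IsLinearMap ℝ fun u => ∫ x in s, φ u x ∂ν where
  map_add u v := by
    rw [← integral_add (hi _) (hi _)]
    exact setIntegral_congr_fun hs fun x hx => (hφ x hx).map_add _ _
  map_smul r u := by
    rw [← integral_smul]
    exact setIntegral_congr_fun hs fun x hx => (hφ x hx).map_smul _ _

end LinearFunctionals

/-- `v_h ↦ s_p(u, v_h)` is a linear functional when `u` is `C²` on each closed element. -/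
theorem isLinearMap_sp (hd : 0 < d) (hβ : ContinuousOn β T.closedDomain) {u : E d → ℝ}
    (hu : ∀ K ∈ T.elements, ContDiffOn ℝ 2 u (simplex K)) :
    IsLinearMap ℝ fun v : T.feSpace 1 => T.sp μ β γ₁ γ₂ u v := by
  have hmass (w : Finset (E d) → Finset (E d) → E d → ℝ)
      (hw : ∀ F, ∀ K ∈ T.elements, ContinuousOn (w K F) (simplex K)) :
      IsLinearMap ℝ fun v : T.feSpace 1 =>
        T.boundaryIntegral (fun K F x => w K F x * u x * v.1 x) := by
    refine isLinearMap_sum _ fun F hF => isLinearMap_sum _ fun K hK => ?_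
    obtain ⟨hF, hcard, -⟩ := T.mem_boundaryFaces.1 hF
    obtain ⟨hK, hFK⟩ := T.mem_elementsAt.1 hK
    exact isLinearMap_setIntegral (measurableSet_simplex F)
      (fun x hx => isLinearMap_const_mul _ (isLinearMap_eval x)) fun v =>
        integrableOn_face hd hF hcard ((((hw F K hK).mul (hu K hK).continuousOn).mul
          (continuousOn_feSpace v hK)).mono (simplex_mono hFK))
  refine isLinearMap_add ?_ (isLinearMap_add
    (hmass (fun _ _ _ => μ * T.meshSize⁻¹) fun _ _ _ => continuousOn_const)
    (hmass _ fun _ _ hK =>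
      (continuous_negPart.comp_continuousOn (continuousOn_normalComponent hβ hK _)).abs))
  simp only [scip_feSpace]
  refine isLinearMap_sum _ fun F hF => ?_
  obtain ⟨hF, hcard, -⟩ := T.mem_interiorFaces.1 hF
  refine isLinearMap_setIntegral (measurableSet_simplex F) (fun x hx =>
    isLinearMap_const_mul _ (isLinearMap_const_mul _ (isLinearMap_sum _ fun K hK =>
      isLinearMap_sum _ fun K' hK' => isLinearMap_inner_right _
        (isLinearMap_jump hK hK' hx)))) fun v => ?_
  exact integrableOn_face hd hF hcard (continuousOn_const.mul (continuousOn_gradJumpProd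
    (fun K hK => continuousOn_gradOn (uniqueDiffOn_element hK) (hu K hK))
    fun K hK => continuousOn_gradOn_feSpace v hK))

/-- A discrete function is bounded on a domain of finite measure, hence in `L²`, and the product of
two `L²` functions is integrable. -/
theorem isLinearMap_load {f : E d → ℝ} (hf : MemLp f 2 (volume.restrict T.domain)) :
    IsLinearMap ℝ fun v : T.feSpace 1 => ∫ x in T.domain, f x * v.1 x := by
  have hsub : T.domain ⊆ T.closedDomain := interior_subset
  have hm : MeasurableSet T.domain := isOpen_interior.measurableSet
  refine isLinearMap_setIntegral hm
    (fun x _ => isLinearMap_const_mul _ (isLinearMap_eval x)) fun v => ?_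
  have hfin : IsFiniteMeasure (volume.restrict T.domain) :=
    ⟨by simpa using (measure_mono hsub).trans_lt T.isCompact_closedDomain.measure_lt_top⟩
  obtain ⟨C, hC⟩ := T.isCompact_closedDomain.exists_bound_of_continuousOn v.2.2.1
  have hv : MemLp v.1 2 (volume.restrict T.domain) :=
    MemLp.of_bound ((v.2.2.1.mono hsub).aestronglyMeasurable hm) C
      ((ae_restrict_mem hm).mono fun x hx => hC x (hsub hx))
  exact hf.integrable_mul hv

end Triangulation

/-! ### Barycentric coordinates and crossing a face -/

namespace Triangulation

variable {T : Triangulation d} {K K' F : Finset (E d)}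

open Classical in
/-- The barycentric coordinate of the element `K` belonging to its vertex `v`. -/
noncomputable def coord (hK : K ∈ T.elements) (v : E d) : E d →ᵃ[ℝ] ℝ :=
  if h : v ∈ K then
    (vertexBasis K (T.complex.indep (T.mem_elements.1 hK).1) (T.mem_elements.1 hK).2).coord ⟨v, h⟩
  else 0

theorem coord_self (hK : K ∈ T.elements) {v : E d} (hv : v ∈ K) : coord hK v v = 1 := by
  rw [coord, dif_pos hv]
  exact AffineBasis.coord_apply_eq _ (⟨v, hv⟩ : K)

theorem coord_of_ne (hK : K ∈ T.elements) {v w : E d} (hw : w ∈ K) (hvw : v ≠ w) :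
    coord hK v w = 0 := by
  rw [coord]
  split_ifs with hv
  · exact AffineBasis.coord_apply_ne _ (i := (⟨v, hv⟩ : K)) (j := ⟨w, hw⟩)
      (fun h => hvw (congrArg Subtype.val h))
  · rfl

theorem mem_simplex_iff_coord (hK : K ∈ T.elements) {x : E d} :
    x ∈ simplex K ↔ ∀ v ∈ K, 0 ≤ coord hK v x := by
  rw [mem_simplex_iff_coord_nonneg (T.complex.indep (T.mem_elements.1 hK).1)
    (T.mem_elements.1 hK).2]
  refine ⟨fun h v hv => ?_, fun h v => ?_⟩
  · rw [coord, dif_pos hv]; exact h _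
  · have := h v v.2
    rwa [coord, dif_pos v.2] at this

theorem sum_coord (hK : K ∈ T.elements) (x : E d) : ∑ v ∈ K, coord hK v x = 1 := by
  rw [← (vertexBasis K (T.complex.indep (T.mem_elements.1 hK).1)
    (T.mem_elements.1 hK).2).sum_coord_apply_eq_one x, ← Finset.sum_coe_sort]
  exact Finset.sum_congr rfl fun v _ => by rw [coord, dif_pos v.2]

theorem sum_coord_smul (hK : K ∈ T.elements) (x : E d) : ∑ v ∈ K, coord hK v x • v = x := by
  conv_rhs => rw [← (vertexBasis K (T.complex.indep (T.mem_elements.1 hK).1)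
    (T.mem_elements.1 hK).2).linear_combination_coord_eq_self x]
  rw [← Finset.sum_coe_sort]
  exact Finset.sum_congr rfl fun v _ => by rw [coord, dif_pos v.2]; rfl

/-- Applied to a coordinate function of a neighbouring element, this gives the change of coordinates
across a common face. -/
theorem affineMap_eq_sum_coord (hK : K ∈ T.elements) (f : E d →ᵃ[ℝ] ℝ) (x : E d) :
    f x = ∑ v ∈ K, coord hK v x * f v := by
  have h (y : E d) : f y = f.linear y + f 0 := congrFun f.decomp y
  have h2 : ∑ v ∈ K, coord hK v x * f v =
      ∑ v ∈ K, (coord hK v x * f.linear v + coord hK v x * f 0) :=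
    Finset.sum_congr rfl fun v _ => by rw [h v]; ring
  rw [h2, Finset.sum_add_distrib, ← Finset.sum_mul, sum_coord hK x, one_mul, h x]
  conv_lhs => rw [← sum_coord_smul hK x]
  simp

/-- A ray starting in `K` in a direction along which the vanishing barycentric coordinates do not
decrease stays in `K` for some time. -/
theorem eventually_mem_simplex (hK : K ∈ T.elements) {y w : E d}
    (h : ∀ v ∈ K, 0 < coord hK v y ∨ 0 ≤ coord hK v y ∧ 0 ≤ (coord hK v).linear w) :
    ∀ᶠ ε : ℝ in 𝓝[>] 0, y + ε • w ∈ simplex K := by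
  simp only [mem_simplex_iff_coord hK]
  rw [eventually_all_finset]
  intro v hv
  -- Each coordinate is affine along the ray: a positive one stays positive for a short time by
  -- continuity, and a nonnegative one with nonnegative slope stays nonnegative.
  have hval (ε : ℝ) : coord hK v (y + ε • w) = coord hK v y + ε * (coord hK v).linear w := by
    rw [add_comm y]
    have := (coord hK v).map_vadd y (ε • w)
    simp only [vadd_eq_add, map_smul, smul_eq_mul] at this
    rw [this]; ring
  simp only [hval]
  rcases h v hv with h | ⟨h0, h1⟩
  · have hc : ContinuousAt (fun ε : ℝ => coord hK v y + ε * (coord hK v).linear w) 0 := by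
      fun_prop
    have := hc.eventually (lt_mem_nhds (a := 0) (by simpa using h))
    exact (this.filter_mono nhdsWithin_le_nhds).mono fun ε hε => hε.le
  · filter_upwards [self_mem_nhdsWithin] with ε hε
    exact add_nonneg h0 (mul_nonneg (le_of_lt hε) h1)

/-- Two different elements with a common face of dimension `d - 1` lie on different sides of it. -/
theorem coord_opposite {a a' y : E d} (ha : a ∉ F) (ha' : a' ∉ F)
    (hK : insert a F ∈ T.elements) (hK' : insert a' F ∈ T.elements)
    (hne : a ≠ a') (hy : ∀ v ∈ F, 0 < coord hK v y) (hya : coord hK a y = 0) :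
    (∃ κ < 0, ∀ p, coord hK' a' p = κ * coord hK a p) ∧
      (∀ v ∈ F, 0 < coord hK' v y) ∧ coord hK' a' y = 0 := by
  have haF {v : E d} (hv : v ∈ F) : v ≠ a := fun h => ha (h ▸ hv)
  have haF' {v : E d} (hv : v ∈ F) : v ≠ a' := fun h => ha' (h ▸ hv)
  have hmem {v : E d} (hv : v ∈ F) : v ∈ insert a F := Finset.mem_insert_of_mem hv
  have hmem' {v : E d} (hv : v ∈ F) : v ∈ insert a' F := Finset.mem_insert_of_mem hv
  have hy' : ∀ v ∈ F, 0 < coord hK' v y := by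
    intro v hv
    rw [affineMap_eq_sum_coord hK, Finset.sum_insert ha, hya, zero_mul, zero_add,
      Finset.sum_eq_single_of_mem v hv, coord_self hK' (hmem' hv), mul_one]
    · exact hy v hv
    · intro u hu huv
      rw [coord_of_ne hK' (hmem' hu) huv.symm, mul_zero]
  -- Both coordinates vanish on the vertices of `F`, so they are proportional; evaluating at `a`
  -- gives the factor.
  have hprop (p : E d) : coord hK' a' p = coord hK' a' a * coord hK a p := by
    rw [affineMap_eq_sum_coord hK, Finset.sum_insert ha, Finset.sum_eq_zero, add_zero, mul_comm]
    intro u hu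
    rw [coord_of_ne hK' (hmem' hu) (haF' hu).symm, mul_zero]
  have hya' : coord hK' a' y = 0 := by rw [hprop, hya, mul_zero]
  refine ⟨⟨_, ?_, hprop⟩, hy', hya'⟩
  -- If the factor were nonnegative, the segment from `y` towards `a` would start inside both
  -- elements. By conformity their intersection lies in the hull of `F`, where the coordinate of `a`
  -- is zero; but at `y + ε • (a - y)` that coordinate equals `ε > 0`.
  by_contra! hκ
  have hpos : 0 < coord hK' a' a := by
    refine lt_of_le_of_ne hκ fun h0 => ?_
    have := hprop a'
    rw [← h0, zero_mul, coord_self hK' (Finset.mem_insert_self _ _)] at this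
    exact one_ne_zero this
  have hlin (f : E d →ᵃ[ℝ] ℝ) (hf : f y = 0) : f.linear (a - y) = f a := by
    have := f.linearMap_vsub a y
    simpa [hf] using this
  have h1 : ∀ᶠ ε : ℝ in 𝓝[>] 0, y + ε • (a - y) ∈ simplex (insert a F) := by
    refine eventually_mem_simplex hK fun v hv => ?_
    rcases Finset.mem_insert.1 hv with rfl | hv
    · exact Or.inr ⟨hya.ge, by rw [hlin _ hya, coord_self hK hv]; exact zero_le_one⟩
    · exact Or.inl (hy v hv)
  have h2 : ∀ᶠ ε : ℝ in 𝓝[>] 0, y + ε • (a - y) ∈ simplex (insert a' F) := by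
    refine eventually_mem_simplex hK' fun v hv => ?_
    rcases Finset.mem_insert.1 hv with rfl | hv
    · exact Or.inr ⟨hya'.ge, by rw [hlin _ hya']; exact hκ⟩
    · exact Or.inl (hy' v hv)
  obtain ⟨ε, ⟨hε1, hε2⟩, hε⟩ := ((h1.and h2).and self_mem_nhdsWithin).exists
  have hz : y + ε • (a - y) ∈ convexHull ℝ (F : Set (E d)) := by
    refine convexHull_mono ?_ (T.complex.inter_subset_convexHull (T.mem_elements.1 hK).1
      (T.mem_elements.1 hK').1 ⟨hε1, hε2⟩)
    rintro v ⟨hv, hv'⟩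
    rcases Finset.mem_insert.1 (Finset.mem_coe.1 hv) with rfl | hv
    · rcases Finset.mem_insert.1 (Finset.mem_coe.1 hv') with h | h
      · exact absurd h hne
      · exact h
    · exact hv
  have hzero : convexHull ℝ (F : Set (E d)) ⊆ coord hK a ⁻¹' {0} := by
    refine convexHull_min (fun v hv => ?_) ((convex_singleton 0).affine_preimage _)
    exact coord_of_ne hK (hmem hv) (haF hv).symm
  have h3 : coord hK a (y + ε • (a - y)) = 0 := hzero hz
  have h4 := (coord hK a).map_vadd y (ε • (a - y))
  rw [vadd_eq_add, vadd_eq_add, map_smul, hlin _ hya, coord_self hK (Finset.mem_insert_self _ _),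
    hya, add_comm, h3] at h4
  simp only [smul_eq_mul, mul_one, add_zero] at h4
  exact (ne_of_gt hε) h4.symm

/-- At most two elements share a face of dimension `d - 1`. -/
theorem card_elementsAt_eq_two {a a' y : E d} (ha : a ∉ F) (ha' : a' ∉ F)
    (hK : insert a F ∈ T.elements) (hK' : insert a' F ∈ T.elements)
    (hne : a ≠ a') (hy : ∀ v ∈ F, 0 < coord hK v y) (hya : coord hK a y = 0) :
    (T.elementsAt F).card = 2 := by
  have hcard : F.card = d := by
    have := (T.mem_elements.1 hK).2
    rw [Finset.card_insert_of_notMem ha] at this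
    omega
  have hpair : T.elementsAt F = {insert a F, insert a' F} := by
    ext K''
    rw [mem_elementsAt, Finset.mem_insert, Finset.mem_singleton]
    constructor
    · rintro ⟨hK'', hF⟩
      obtain ⟨a'', ha'', rfl⟩ := Finset.exists_eq_insert_iff.2
        ⟨hF, by rw [hcard, (T.mem_elements.1 hK'').2]⟩
      by_contra! hcon
      have hne1 : a ≠ a'' := fun h => hcon.1 (by rw [h])
      have hne2 : a' ≠ a'' := fun h => hcon.2 (by rw [h])
      -- Three distinct elements at `F` would lie pairwise on opposite sides. Composing the
      -- coordinate changes gives `κ' = κ'' * κ`, impossible for three negative numbers.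
      obtain ⟨⟨κ, hκ, h1⟩, hy', hya'⟩ := coord_opposite ha ha' hK hK' hne hy hya
      obtain ⟨⟨κ', hκ', h2⟩, -⟩ := coord_opposite ha ha'' hK hK'' hne1 hy hya
      obtain ⟨⟨κ'', hκ'', h3⟩, -⟩ := coord_opposite ha' ha'' hK' hK'' hne2 hy' hya'
      have h4 := h3 a
      rw [h2, h1, coord_self hK (Finset.mem_insert_self _ _)] at h4
      nlinarith [mul_pos_of_neg_of_neg hκ hκ'']
    · rintro (rfl | rfl)
      · exact ⟨hK, Finset.subset_insert _ _⟩
      · exact ⟨hK', Finset.subset_insert _ _⟩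
  rw [hpair, Finset.card_pair]
  intro h
  have : a ∈ insert a' F := h ▸ Finset.mem_insert_self _ _
  rcases Finset.mem_insert.1 this with h | h
  · exact hne h
  · exact ha h

end Triangulation

/-! ### Unique continuation along generic rays -/

namespace Triangulation

variable {T : Triangulation d}

variable (T) in
/-- From any point there is a direction whose ray avoids all faces of codimension at least two. -/
theorem exists_generic_direction (hd : 0 < d) (x : E d) : ∃ w : E d, w ≠ 0 ∧
    ∀ s ∈ T.complex.faces, s.card < d → w ∉ Submodule.span ℝ ((fun v => v - x) '' (s : Set (E d))) := by
  classical
  -- Fewer than `d` vectors span a proper subspace, and a real vector space is not a finite union of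
  -- proper subspaces. The zero subspace is included to force `w ≠ 0`.
  let 𝓕 : Finset (Submodule ℝ (E d)) :=
    insert ⊥ ((T.finite.toFinset.filter fun s => s.card < d).image
      fun s : Finset (E d) => Submodule.span ℝ ((fun v => v - x) '' (s : Set (E d))))
  have htop : ⊤ ∉ 𝓕 := by
    intro h
    have hfr : finrank ℝ (⊤ : Submodule ℝ (E d)) = d := by simp
    rcases Finset.mem_insert.1 h with h | h
    · rw [h, finrank_bot] at hfr
      omega
    · obtain ⟨s, hs, hst⟩ := Finset.mem_image.1 h
      have hcard := (Finset.mem_filter.1 hs).2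
      have := finrank_span_finset_le_card (R := ℝ) (s.image fun v => v - x)
      rw [Finset.coe_image, Set.finrank, hst, hfr] at this
      have := this.trans Finset.card_image_le
      omega
  obtain ⟨w, hw⟩ := (Set.ne_univ_iff_exists_notMem _).1
    (Subspace.biUnion_ne_univ_of_top_notMem htop)
  simp only [mem_iUnion, not_exists] at hw
  refine ⟨w, fun h => hw ⊥ (Finset.mem_insert_self _ _) (by simp [h]), fun s hs hcard => ?_⟩
  exact hw _ (Finset.mem_insert_of_mem (Finset.mem_image_of_mem _
    (Finset.mem_filter.2 ⟨T.finite.mem_toFinset.2 hs, hcard⟩)))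

/-- A continuous piecewise affine function without gradient jumps over interior faces which vanishes
on the boundary faces vanishes in the interior of every element. -/
theorem eq_zero_of_mem_interior_simplex (hd : 0 < d) (u : T.feSpace 1)
    (hjump : ∀ F ∈ T.interiorFaces, ∀ K ∈ T.elementsAt F, ∀ K' ∈ T.elementsAt F,
      ∀ x ∈ simplex F, gradOn K u.1 x = gradOn K' u.1 x)
    (hbd : ∀ F ∈ T.boundaryFaces, ∀ x ∈ simplex F, u.1 x = 0)
    {K₀ : Finset (E d)} (hK₀ : K₀ ∈ T.elements) {x : E d} (hx : x ∈ interior (simplex K₀)) :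
    u.1 x = 0 := by
  classical
  by_contra hux
  obtain ⟨g, b, hu₀⟩ := exists_affineOn u hK₀
  have hxK : x ∈ simplex K₀ := interior_subset hx
  -- Genericity is invariant under `w ↦ -w`, so the sign can be chosen to keep the affine function
  -- from moving towards zero along the ray.
  obtain ⟨w, hw0, hwgen, hwdir⟩ : ∃ w : E d, w ≠ 0 ∧ (∀ s ∈ T.complex.faces, s.card < d →
      w ∉ Submodule.span ℝ ((fun v => v - x) '' (s : Set (E d)))) ∧ 0 ≤ u.1 x * ⟪g, w⟫_ℝ := by
    obtain ⟨w, hw0, hw⟩ := T.exists_generic_direction hd x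
    rcases le_total 0 (u.1 x * ⟪g, w⟫_ℝ) with h | h
    · exact ⟨w, hw0, hw, h⟩
    · exact ⟨-w, neg_ne_zero.2 hw0,
        fun s hs hc hm => hw s hs hc ((Submodule.neg_mem_iff _).1 hm), by
          rw [inner_neg_right]; linarith⟩
  -- the union of the elements on which `u` continues the affine function of `K₀`
  let C := T.elements.filter fun K => ∀ z ∈ simplex K, u.1 z = ⟪g, z⟫_ℝ + b
  have hC {K : Finset (E d)} : K ∈ C ↔ K ∈ T.elements ∧ ∀ z ∈ simplex K, u.1 z = ⟪g, z⟫_ℝ + b :=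
    Finset.mem_filter
  let S : Set (E d) := ⋃ K ∈ C, simplex K
  have hS : IsCompact S := C.finite_toSet.isCompact_biUnion fun K _ => isCompact_simplex K
  have hSmem {K : Finset (E d)} (hK : K ∈ C) {z : E d} (hz : z ∈ simplex K) : z ∈ S :=
    mem_biUnion (Finset.mem_coe.2 hK) hz
  let A : Set ℝ := (fun t : ℝ => x + t • w) ⁻¹' S ∩ Ici 0
  have hAclosed : IsClosed A := (hS.isClosed.preimage (by fun_prop)).inter isClosed_Ici
  have h0A : (0 : ℝ) ∈ A := ⟨by simpa using hSmem (hC.2 ⟨hK₀, hu₀⟩) hxK, self_mem_Ici⟩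
  have hAbdd : BddAbove A := by
    obtain ⟨R, hR⟩ := hS.isBounded.subset_closedBall x
    refine ⟨R / ‖w‖, fun t ht => ?_⟩
    have h1 := hR ht.1
    have h2 : (0 : ℝ) ≤ t := ht.2
    rw [Metric.mem_closedBall, dist_eq_norm, add_sub_cancel_left, norm_smul, Real.norm_eq_abs,
      abs_of_nonneg h2] at h1
    exact (le_div_iff₀ (norm_pos_iff.2 hw0)).2 h1
  -- This is the last time in the union rather than the first exit: the ray may leave and return,
  -- but the affine formula still holds at its last point in the union.
  obtain ⟨t, ht⟩ : ∃ t, IsGreatest A t :=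
    ⟨sSup A, hAclosed.csSup_mem ⟨0, h0A⟩ hAbdd, fun _ h => le_csSup hAbdd h⟩
  set y : E d := x + t • w with hydef
  -- By maximality of `t`, the ray cannot continue from `y` inside any element of `C`.
  have hexit {K : Finset (E d)} (hK : K ∈ C) :
      ¬ ∀ᶠ ε : ℝ in 𝓝[>] 0, y + ε • w ∈ simplex K := by
    intro h
    obtain ⟨ε, h1, hε⟩ := (h.and self_mem_nhdsWithin).exists
    have hε : (0 : ℝ) < ε := hε
    have h2 : t + ε ∈ A := by
      refine ⟨?_, add_nonneg ht.1.2 hε.le⟩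
      have h3 : x + (t + ε) • w = y + ε • w := by rw [hydef, add_smul, add_assoc]
      rw [mem_preimage, h3]
      exact hSmem hK h1
    linarith [ht.2 h2]
  have htpos : 0 < t := by
    refine lt_of_le_of_ne ht.1.2 fun h => hexit (hC.2 ⟨hK₀, hu₀⟩) ?_
    have hy : y = x := by rw [hydef, ← h]; simp
    rw [hy]
    have hc : ContinuousAt (fun ε : ℝ => x + ε • w) 0 := by fun_prop
    have := hc.eventually (mem_interior_iff_mem_nhds.1
      (by rw [zero_smul, add_zero]; exact hx : x + (0 : ℝ) • w ∈ interior (simplex K₀)))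
    exact this.filter_mono nhdsWithin_le_nhds
  obtain ⟨K, hKC, hyK⟩ : ∃ K ∈ C, y ∈ simplex K := by
    have := ht.1.1
    simpa [S] using this
  obtain ⟨hK, huK⟩ := hC.1 hKC
  have hKf := T.mem_elements.1 hK
  have hnn := (mem_simplex_iff_coord hK).1 hyK
  -- By the choice of sign, `u x * u y = (u x)² + t * (u x * ⟪g, w⟫)` is at least `(u x)² > 0`.
  have huy : u.1 y ≠ 0 := by
    have h1 : u.1 y = u.1 x + t * ⟪g, w⟫_ℝ := by
      rw [huK y hyK, hu₀ x hxK, hydef, inner_add_right, real_inner_smul_right]; ring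
    intro h2
    have h3 : 0 < u.1 x * u.1 x := mul_self_pos.2 hux
    have h4 : u.1 x * u.1 y = u.1 x * u.1 x + t * (u.1 x * ⟪g, w⟫_ℝ) := by rw [h1]; ring
    rw [h2, mul_zero] at h4
    nlinarith [mul_nonneg htpos.le hwdir]
  -- the exit point lies on a face of dimension at least `d - 1`
  have hunique : ∀ a ∈ K, coord hK a y = 0 → ∀ v ∈ K.erase a, 0 < coord hK v y := by
    intro a ha hya v hv
    obtain ⟨hva, hvK⟩ := Finset.mem_erase.1 hv
    refine lt_of_le_of_ne (hnn v hvK) fun h0 => ?_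
    let s := (K.erase a).erase v
    have hsK : s ⊆ K := (Finset.erase_subset _ _).trans (Finset.erase_subset _ _)
    have hscard : s.card < d := by
      rw [Finset.card_erase_of_mem hv, Finset.card_erase_of_mem ha, hKf.2]
      omega
    have hsum {M : Type} [AddCommMonoid M] (φ : E d → M) (h1 : φ a = 0) (h2 : φ v = 0) :
        ∑ i ∈ K, φ i = ∑ i ∈ s, φ i := by
      rw [← Finset.add_sum_erase K φ ha, ← Finset.add_sum_erase _ φ hv, h1, h2, zero_add, zero_add]
    have hs1 : ∑ i ∈ s, coord hK i y = 1 := by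
      rw [← hsum (fun i => coord hK i y) hya h0.symm, sum_coord hK y]
    have hs2 : ∑ i ∈ s, coord hK i y • i = y := by
      rw [← hsum (fun i => coord hK i y • i) (by simp [hya]) (by simp [← h0]), sum_coord_smul hK y]
    have hsne : s.Nonempty := by
      rw [Finset.nonempty_iff_ne_empty]
      intro h
      rw [h, Finset.sum_empty] at hs1
      exact zero_ne_one hs1
    refine hwgen s (T.complex.down_closed hKf.1 hsK hsne) hscard ?_
    -- With two vanishing coordinates, `y` is an affine combination of the `d - 1` vertices in `s`.
    -- As the weights sum to one, `t • w = y - x` lies in the span that `w` avoids.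
    have htw : t • w = ∑ i ∈ s, coord hK i y • (i - x) := by
      simp only [smul_sub, Finset.sum_sub_distrib, ← Finset.sum_smul, hs1, hs2, one_smul]
      rw [hydef, add_sub_cancel_left]
    have hmem : t • w ∈ Submodule.span ℝ ((fun v => v - x) '' (s : Set (E d))) := by
      rw [htw]
      exact Submodule.sum_mem _ fun i hi => Submodule.smul_mem _ _
        (Submodule.subset_span (mem_image_of_mem _ hi))
    exact (Submodule.smul_mem_iff _ htpos.ne').1 hmem
  -- If all coordinates were positive, the ray would continue inside `K`.
  obtain ⟨a, ha, hya⟩ : ∃ a ∈ K, coord hK a y = 0 := by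
    by_contra! h
    exact hexit hKC (eventually_mem_simplex hK fun v hv =>
      Or.inl (lt_of_le_of_ne (hnn v hv) (h v hv).symm))
  obtain ⟨F, haF, rfl⟩ : ∃ F, a ∉ F ∧ insert a F = K :=
    ⟨K.erase a, Finset.notMem_erase _ _, Finset.insert_erase ha⟩
  have hy : ∀ v ∈ F, 0 < coord hK v y := by
    intro v hv
    refine hunique a ha hya v ?_
    rwa [Finset.erase_insert haF]
  have hFcard : F.card = d := by
    have := hKf.2
    rw [Finset.card_insert_of_notMem haF] at this
    omega
  have hFne : F.Nonempty := Finset.card_pos.1 (by omega)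
  have hFf : F ∈ T.complex.faces :=
    T.complex.down_closed hKf.1 (Finset.subset_insert _ _) hFne
  have hyF : y ∈ simplex F := by
    have h1 := sum_coord hK y
    have h2 := sum_coord_smul hK y
    rw [Finset.sum_insert haF, hya, zero_add] at h1
    rw [Finset.sum_insert haF, hya, zero_smul, zero_add] at h2
    rw [← h2]
    exact (convex_simplex F).sum_mem (fun v hv => (hy v hv).le) h1 fun v hv => subset_simplex F hv
  have hKat : insert a F ∈ T.elementsAt F := T.mem_elementsAt.2 ⟨hK, Finset.subset_insert _ _⟩
  by_cases hother : ∃ K' ∈ T.elementsAt F, K' ≠ insert a F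
  · obtain ⟨K', hK'at, hne⟩ := hother
    obtain ⟨hK', hFK'⟩ := T.mem_elementsAt.1 hK'at
    obtain ⟨a', haF', rfl⟩ := Finset.exists_eq_insert_iff.2
      ⟨hFK', by rw [hFcard, (T.mem_elements.1 hK').2]⟩
    have haa' : a ≠ a' := fun h => hne (by rw [h])
    have hint : F ∈ T.interiorFaces := T.mem_interiorFaces.2
      ⟨hFf, hFcard, card_elementsAt_eq_two haF haF' hK hK' haa' hy hya⟩
    obtain ⟨⟨κ, hκ, hprop⟩, hy', hya'⟩ := coord_opposite haF haF' hK hK' haa' hy hya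
    -- The absence of a gradient jump gives equal slopes, and the common value at `y` gives equal
    -- constants.
    have hK'C : insert a' F ∈ C := by
      obtain ⟨g', b', hu'⟩ := exists_affineOn u hK'
      have hyK' := simplex_mono hFK' hyF
      have hg : g' = g := by
        have := hjump F hint _ hKat _ hK'at y hyF
        rwa [gradOn_of_affineOn (uniqueDiffOn_element hK) huK hyK,
          gradOn_of_affineOn (uniqueDiffOn_element hK') hu' hyK', eq_comm] at this
      have hb : b' = b := by
        have := (hu' y hyK').symm.trans (huK y hyK)
        rw [hg] at this
        linarith
      exact hC.2 ⟨hK', by rwa [hg, hb] at hu'⟩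
    have hlin (f : E d →ᵃ[ℝ] ℝ) (hf : f y = 0) : f.linear w = f (y + w) := by
      have := f.map_vadd y w
      rw [vadd_eq_add, vadd_eq_add, hf, add_zero, add_comm] at this
      exact this.symm
    -- The slope of the coordinate opposite `F` decides which element the ray enters: the two
    -- opposite coordinates differ by the negative factor `κ`, so at least one of them does not
    -- decrease.
    rcases le_total 0 ((coord hK a).linear w) with hsign | hsign
    · refine hexit hKC (eventually_mem_simplex hK fun v hv => ?_)
      rcases Finset.mem_insert.1 hv with rfl | hv
      · exact Or.inr ⟨hya.ge, hsign⟩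
      · exact Or.inl (hy v hv)
    · refine hexit hK'C (eventually_mem_simplex hK' fun v hv => ?_)
      rcases Finset.mem_insert.1 hv with rfl | hv
      · refine Or.inr ⟨hya'.ge, ?_⟩
        rw [hlin _ hya', hprop, ← hlin _ hya]
        exact mul_nonneg_of_nonpos_of_nonpos hκ.le hsign
      · exact Or.inl (hy' v hv)
  · push Not at hother
    have hone : T.elementsAt F = {insert a F} :=
      Finset.eq_singleton_iff_unique_mem.2 ⟨hKat, hother⟩
    exact huy (hbd F (T.mem_boundaryFaces.2 ⟨hFf, hFcard, by rw [hone, Finset.card_singleton]⟩)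
      y hyF)

/-- A continuous piecewise affine function without gradient jumps over interior faces which vanishes
on the boundary faces is zero. -/
theorem eq_zero_of_gradOn_eq_of_boundary (hd : 0 < d) (u : T.feSpace 1)
    (hjump : ∀ F ∈ T.interiorFaces, ∀ K ∈ T.elementsAt F, ∀ K' ∈ T.elementsAt F,
      ∀ x ∈ simplex F, gradOn K u.1 x = gradOn K' u.1 x)
    (hbd : ∀ F ∈ T.boundaryFaces, ∀ x ∈ simplex F, u.1 x = 0) : u = 0 := by
  apply Subtype.ext
  funext x
  by_cases hx : x ∈ T.closedDomain
  · obtain ⟨K, hK, hxK⟩ := exists_element_of_mem_closedDomain hx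
    have hKf := T.mem_elements.1 hK
    -- A simplex of full dimension is contained in the closure of its interior, so vanishing extends
    -- to the closed element by continuity.
    have hcl : simplex K ⊆ closure (interior (simplex K)) := by
      rw [(convex_simplex K).closure_interior_eq_closure_of_nonempty_interior
        (interior_simplex_nonempty (T.complex.indep hKf.1) hKf.2)]
      exact subset_closure
    have heq : EqOn u.1 0 (simplex K) := by
      refine EqOn.of_subset_closure (s := interior (simplex K)) (fun z hz => ?_)
        (continuousOn_feSpace u hK) continuousOn_const interior_subset hcl
      exact eq_zero_of_mem_interior_simplex hd u hjump hbd hK hz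
    exact heq hxK
  · exact u.2.1 x hx

/-! ### Definiteness of the stabilisation and unique solvability -/

variable {μ θ : ℝ} {β : E d → E d} {c : E d → ℝ} {γ₁ γ₂ : Finset (E d) → ℝ}

theorem gradJumpProd_self_nonneg (F : Finset (E d)) (u : E d → ℝ) (x : E d) :
    0 ≤ T.gradJumpProd F u u x :=
  mul_nonneg (by norm_num) (Finset.sum_nonneg fun _ _ => Finset.sum_nonneg fun _ _ =>
    real_inner_self_nonneg)

/-- The diffusive part `m * μ` of the lower bound is already positive; the convective part only has
to be nonnegative. -/
theorem AdmissibleParameters.gamma_pos (hμ : 0 < μ) (hγ : T.AdmissibleParameters μ β γ₁ γ₂)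
    {F : Finset (E d)} (hF : F ∈ T.interiorFaces) : 0 < γ₁ F := by
  obtain ⟨⟨m, M, hm, -, h⟩, -⟩ := hγ
  obtain ⟨K, hK⟩ : (T.elementsAt F).Nonempty :=
    Finset.card_pos.1 (by rw [(T.mem_interiorFaces.1 hF).2.2]; norm_num)
  refine lt_of_lt_of_le (mul_pos hm (add_pos_of_pos_of_nonneg hμ (mul_nonneg ?_ ?_))) (h F hF K hK).1
  · exact Real.iSup_nonneg fun _ => abs_nonneg _
  · exact Metric.diam_nonneg

theorem meshSize_pos (hd : 0 < d) {K : Finset (E d)} (hK : K ∈ T.elements) : 0 < T.meshSize := by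
  refine (diam_pos_of_one_lt_card (s := K) ?_).trans_le
    (le_csSup (T.elements.finite_toSet.image _).bddAbove (mem_image_of_mem _ hK))
  rw [(T.mem_elements.1 hK).2]
  omega

theorem scip_self_nonneg (hμ : 0 < μ) (hγ : T.AdmissibleParameters μ β γ₁ γ₂) (u : T.feSpace 1) :
    0 ≤ T.scip γ₁ γ₂ u u := by
  rw [scip_feSpace]
  exact Finset.sum_nonneg fun F hF => faceIntegral_nonneg fun x _ =>
    mul_nonneg (mul_nonneg Metric.diam_nonneg (hγ.gamma_pos hμ hF).le)
      (gradJumpProd_self_nonneg F _ x)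

theorem boundaryIntegral_nonneg {g : Finset (E d) → Finset (E d) → E d → ℝ}
    (hg : ∀ F K x, 0 ≤ g K F x) : 0 ≤ T.boundaryIntegral g :=
  Finset.sum_nonneg fun F _ => Finset.sum_nonneg fun K _ => faceIntegral_nonneg fun x _ => hg F K x

theorem meshSize_nonneg : 0 ≤ T.meshSize :=
  Real.sSup_nonneg (by rintro _ ⟨K, -, rfl⟩; exact Metric.diam_nonneg)

theorem sbc_self_nonneg (hμ : 0 < μ) (σ : ℝ → ℝ) (u : E d → ℝ) : 0 ≤ T.sbc σ μ β u u :=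
  add_nonneg
    (boundaryIntegral_nonneg fun F K x => by
      rw [mul_assoc]
      exact mul_nonneg (mul_nonneg hμ.le (inv_nonneg.2 meshSize_nonneg)) (mul_self_nonneg _))
    (boundaryIntegral_nonneg fun F K x => by
      rw [mul_assoc]; exact mul_nonneg (abs_nonneg _) (mul_self_nonneg _))

/-- The stabilisation is definite on continuous piecewise affine functions. -/
theorem eq_zero_of_stabilisation_eq_zero (hd : 1 < d) (hμ : 0 < μ)
    (hγ : T.AdmissibleParameters μ β γ₁ γ₂) {σ : ℝ → ℝ} {u : T.feSpace 1}
    (h : T.scip γ₁ γ₂ u u + T.sbc σ μ β u u = 0) : u = 0 := by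
  have hd0 : 0 < d := by omega
  have h1 := scip_self_nonneg hμ hγ u
  have h2 := sbc_self_nonneg (T := T) (β := β) hμ σ u.1
  have hscip : T.scip γ₁ γ₂ u u = 0 := by linarith
  -- Only this term controls the boundary values, since the convective weight may vanish; this is
  -- why the argument works for any `σ`.
  have hmass : T.boundaryIntegral (fun _ _ x => μ * T.meshSize⁻¹ * u.1 x * u.1 x) = 0 := by
    have h3 : 0 ≤ T.boundaryIntegral (fun _ _ x => μ * T.meshSize⁻¹ * u.1 x * u.1 x) :=
      boundaryIntegral_nonneg fun F K x => by
        rw [mul_assoc]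
        exact mul_nonneg (mul_nonneg hμ.le (inv_nonneg.2 meshSize_nonneg)) (mul_self_nonneg _)
    have h4 : 0 ≤ T.boundaryIntegral (fun K F x => |σ ⟪β x, normal K F⟫_ℝ| * u.1 x * u.1 x) :=
      boundaryIntegral_nonneg fun F K x => by
        rw [mul_assoc]; exact mul_nonneg (abs_nonneg _) (mul_self_nonneg _)
    have h5 : T.sbc σ μ β u u = 0 := by linarith
    rw [sbc] at h5
    linarith
  refine eq_zero_of_gradOn_eq_of_boundary hd0 u (fun F hF K hK K' hK' x hx => ?_)
    fun F hF x hx => ?_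
  · obtain ⟨hFf, hcard, -⟩ := T.mem_interiorFaces.1 hF
    -- Here `d ≥ 2` matters: for `d = 1` a face is a point of diameter zero and the penalty weight
    -- would vanish.
    have hdiam : 0 < diam F := diam_pos_of_one_lt_card (by omega)
    have hγF := hγ.gamma_pos hμ hF
    have hpos : ∀ G ∈ T.interiorFaces, ∀ z : E d,
        0 ≤ diam G * γ₁ G * T.gradJumpProd G u.1 u.1 z := fun G hG z =>
      mul_nonneg (mul_nonneg Metric.diam_nonneg (hγ.gamma_pos hμ hG).le)
        (gradJumpProd_self_nonneg G _ z)
    rw [scip_feSpace] at hscip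
    have hscip := (Finset.sum_eq_zero_iff_of_nonneg
      fun G hG => faceIntegral_nonneg fun z _ => hpos G hG z).1 hscip F hF
    have hzero := eq_zero_of_faceIntegral_eq_zero hd0 hFf hcard
      (continuousOn_const.mul (continuousOn_gradJumpProd
        (fun K hK => continuousOn_gradOn_feSpace u hK)
        fun K hK => continuousOn_gradOn_feSpace u hK)) (fun z _ => hpos F hF z) hscip hx
    have hjump := (mul_eq_zero.1 hzero).resolve_left (mul_pos hdiam hγF).ne'
    -- The jump product of `u` with itself is half a sum of squared norms over ordered pairs of
    -- elements, so every single jump vanishes.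
    rw [gradJumpProd, mul_eq_zero, or_iff_right (by norm_num),
      Finset.sum_eq_zero_iff_of_nonneg fun _ _ => Finset.sum_nonneg fun _ _ =>
        real_inner_self_nonneg] at hjump
    have hjump := (Finset.sum_eq_zero_iff_of_nonneg fun _ _ => real_inner_self_nonneg).1
      (hjump K hK) K' hK'
    exact sub_eq_zero.1 (inner_self_eq_zero.1 hjump)
  · obtain ⟨hFf, hcard, hone⟩ := T.mem_boundaryFaces.1 hF
    obtain ⟨K, hK⟩ : (T.elementsAt F).Nonempty := Finset.card_pos.1 (by omega)
    obtain ⟨hKe, hFK⟩ := T.mem_elementsAt.1 hK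
    have hpos (z : E d) : 0 ≤ μ * T.meshSize⁻¹ * u.1 z * u.1 z := by
      rw [mul_assoc]
      exact mul_nonneg (mul_nonneg hμ.le (inv_nonneg.2 meshSize_nonneg)) (mul_self_nonneg _)
    rw [boundaryIntegral, Finset.sum_eq_zero_iff_of_nonneg fun _ _ => Finset.sum_nonneg
      fun _ _ => faceIntegral_nonneg fun z _ => hpos z] at hmass
    have hmass := (Finset.sum_eq_zero_iff_of_nonneg fun _ _ =>
      faceIntegral_nonneg fun z _ => hpos z).1 (hmass F hF) K hK
    have hcont := (continuousOn_feSpace u hKe).mono (simplex_mono hFK)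
    have hzero := eq_zero_of_faceIntegral_eq_zero hd0 hFf hcard
      ((continuousOn_const.mul hcont).mul hcont) (fun z _ => hpos z) hmass hx
    have hcoef : μ * T.meshSize⁻¹ ≠ 0 := (mul_pos hμ (inv_pos.2 (meshSize_pos hd0 hKe))).ne'
    rw [mul_assoc] at hzero
    exact mul_self_eq_zero.1 ((mul_eq_zero.1 hzero).resolve_left hcoef)

/-- A stabilised primal-dual system on a finite-dimensional space with definite stabilisations is
uniquely solvable for all data. -/
theorem existsUnique_primalDual {V : Type*} [AddCommGroup V] [Module ℝ V] [FiniteDimensional ℝ V]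
    (A P Q : V →ₗ[ℝ] V →ₗ[ℝ] ℝ) (hP : ∀ u, 0 ≤ P u u) (hQ : ∀ u, 0 ≤ Q u u)
    (hP0 : ∀ u, P u u = 0 → u = 0) (hQ0 : ∀ u, Q u u = 0 → u = 0) (f ℓ : V →ₗ[ℝ] ℝ) :
    ∃! p : V × V, (∀ w, A p.1 w + Q p.2 w = f w) ∧ ∀ v, A v p.2 - P p.1 v = -ℓ v := by
  -- The whole system becomes one linear map between spaces of equal dimension, so injectivity gives
  -- bijectivity.
  let Φ : V × V →ₗ[ℝ] Dual ℝ V × Dual ℝ V :=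
    LinearMap.prod (A.coprod Q) ((-P).coprod A.flip)
  have hΦ (p : V × V) : ((∀ w, A p.1 w + Q p.2 w = f w) ∧ ∀ v, A v p.2 - P p.1 v = -ℓ v) ↔
      Φ p = (f, -ℓ) := by
    simp only [Φ, LinearMap.prod_apply, Function.prod_apply, Prod.mk.injEq, LinearMap.ext_iff,
      LinearMap.coprod_apply, LinearMap.add_apply, LinearMap.neg_apply, LinearMap.flip_apply,
      sub_eq_neg_add]
  have hinj : Function.Injective Φ := by
    rw [← LinearMap.ker_eq_bot, LinearMap.ker_eq_bot']
    rintro ⟨u, z⟩ h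
    -- Testing the first equation with `z` and the second with `u` produces the same term `A u z`;
    -- subtracting leaves `P u u + Q z z = 0`.
    have h1 : A u z + Q z z = 0 := LinearMap.congr_fun (congrArg Prod.fst h) z
    have h2 : -P u u + A u z = 0 := LinearMap.congr_fun (congrArg Prod.snd h) u
    rw [hP0 u (by linarith [hP u, hQ z]), hQ0 z (by linarith [hP u, hQ z])]
    rfl
  have hsurj : Function.Surjective Φ :=
    (LinearMap.injective_iff_surjective_of_finrank_eq_finrank (by simp)).1 hinj
  simp only [hΦ]
  exact Function.Bijective.existsUnique ⟨hinj, hsurj⟩ _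

/-- Unique solvability of the stabilised method for arbitrary linear data. -/
theorem existsUnique_isFEMSolution (hd : 1 < d) (hμ : 0 < μ)
    (hβ : ContDiffOn ℝ 2 β T.closedDomain) (hc : ContDiffOn ℝ 1 c T.closedDomain)
    (hγ : T.AdmissibleParameters μ β γ₁ γ₂) {f : E d → ℝ}
    (hf : MemLp f 2 (volume.restrict T.domain)) (ℓ : T.feSpace 1 →ₗ[ℝ] ℝ) :
    ∃! p : T.feSpace 1 × T.feSpace 1, T.IsFEMSolution 1 μ β c θ γ₁ γ₂ f ℓ p.1 p.2 := by
  have hd0 : 0 < d := by omega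
  exact existsUnique_primalDual (isBilinearMap_ah (θ := θ) hd0 hβ hc).toLinearMap
    (isBilinearMap_sp (γ₁ := γ₁) (γ₂ := γ₂) (μ := μ) hd0 hβ.continuousOn).toLinearMap
    (isBilinearMap_sa (γ₁ := γ₁) (γ₂ := γ₂) (μ := μ) hd0 hβ.continuousOn).toLinearMap
    (fun u => add_nonneg (scip_self_nonneg hμ hγ u) (sbc_self_nonneg hμ _ _))
    (fun u => add_nonneg (scip_self_nonneg hμ hγ u) (sbc_self_nonneg hμ _ _))
    (fun _ h => eq_zero_of_stabilisation_eq_zero hd hμ hγ h)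
    (fun _ h => eq_zero_of_stabilisation_eq_zero hd hμ hγ h)
    ((isLinearMap_load hf).mk' _) ℓ

end Triangulation
end NonCoerciveFEM

theorem mainTheorem11 (d : ℕ) (hd : d = 2 ∨ d = 3) (T : NonCoerciveFEM.Triangulation d)
    (μ : ℝ) (hμ : 0 < μ)
    (β : NonCoerciveFEM.E d → NonCoerciveFEM.E d) (hβ : ContDiffOn ℝ 2 β T.closedDomain)
    (c : NonCoerciveFEM.E d → ℝ) (hc : ContDiffOn ℝ 1 c T.closedDomain)
    (θ : ℝ)
    (γ₁ γ₂ : Finset (NonCoerciveFEM.E d) → ℝ) (hγ : T.AdmissibleParameters μ β γ₁ γ₂)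
    (f : NonCoerciveFEM.E d → ℝ)
    (hf : MeasureTheory.MemLp f 2 (MeasureTheory.volume.restrict T.domain)) :
    (∀ u : NonCoerciveFEM.E d → ℝ,
      (∀ K ∈ T.elements, ContDiffOn ℝ 2 u (NonCoerciveFEM.simplex K)) →
      ∃! p : T.feSpace 1 × T.feSpace 1,
        T.IsFEMSolution 1 μ β c θ γ₁ γ₂ f (fun vh => T.sp μ β γ₁ γ₂ u vh) p.1 p.2) ∧
    (∀ ℓ : T.feSpace 1 →ₗ[ℝ] ℝ,
      ∃! p : T.feSpace 1 × T.feSpace 1,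
        T.IsFEMSolution 1 μ β c θ γ₁ γ₂ f ℓ p.1 p.2) := by
  have hd1 : 1 < d := by omega
  refine ⟨fun u hu => ?_, fun ℓ =>
    NonCoerciveFEM.Triangulation.existsUnique_isFEMSolution hd1 hμ hβ hc hγ hf ℓ⟩
  -- The consistent right-hand side is a particular linear functional, because `u` is `C²` on each
  -- closed element.
  exact NonCoerciveFEM.Triangulation.existsUnique_isFEMSolution hd1 hμ hβ hc hγ hf
    ((NonCoerciveFEM.Triangulation.isLinearMap_sp (by omega) hβ.continuousOn hu).mk' _)
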